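/- Let $n\ge 0$ and let $Q$ be the bipartite type $A$ quiver $$y_n\xrightarrow{\beta_n}x_n\xleftarrow{\alpha_n}y_{n-1}\xrightarrow{\beta_{n-1}}\cdots\xrightarrow{\beta_1}x_1\xleftarrow{\alpha_1}y_0$$ with dimension vector $\mathbf d:Q_0\to\mathbb Z_{\ge 0}$. Let $\mathbb K$ be a field, let $\mathtt{rep}_Q(\mathbf d)=\prod_{a\in Q_1}\mathrm{Mat}(\mathbf d(ta),\mathbf d(ha))$, where $ta$ and $ha$ denote the tail and head of the arrow $a$ and matrices have entries in $\mathbb K$, and let $\mathbf{GL}(\mathbf d)=\prod_{z\in Q_0}\mathbf{GL}_{\mathbf d(z)}(\mathbb K)$ act on it by $(V_a)_a\bullet(g_z)_z=(g_{ta}^{-1}V_ag_{ha})_a$. Let $\Omega^\circ$ be the orbit of some $V\in\mathtt{rep}_Q(\mathbf d)$ and let $\Omega$, a quiver locus, be its Zariski closure. If $\mathbb K$ is finite, closures are understood geometrically. Precisely, fix any infinite extension field $\mathbb L$ of $\mathbb K$ (one may take $\mathbb L=\mathbb K$ if $\mathbb K$ is infinite). Then $\Omega$ is the set of common zeros in the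 space of $\mathbb L$-points of $\mathtt{rep}_Q(\mathbf d)$ of all polynomials over $\mathbb K$ that vanish on the orbit of $V$ under $\prod_z\mathbf{GL}_{\mathbf d(z)}(\mathbb L)$, and $\operatorname{codim}\Omega$ is the height of the ideal of $\Omega$ in the coordinate ring $\mathbb K[\mathtt{rep}_Q(\mathbf d)]$. A lacing diagram is a tuple $\mathbf w=(w_a)_{a\in Q_1}\in\mathtt{rep}_Q(\mathbf d)$ of partial permutation matrices ($0$/$1$-matrices with at most one $1$ in each row and each column). The completion $c(w)$ of a partial permutation matrix $w$ is the permutation matrix of smallest possible size, and of minimal length for that size, that has $w$ as its northwest corner; $\mathrm{rot}$ denotes rotation of a matrix by $180$ degrees. The extended lacing diagram of $\mathbf w$ is the tuple of permutations $v_a=c(w_a)$ for the right-pointing arrows $a=\beta_i$ and $v_a=\mathrm{rot}(c(\mathrm{rot}(w_a)))$ for the left-pointing arrows $a=\alpha_i$. Its number of crossings is $|\mathbf w|=\sum_{a\in Q_1}\ell(v_a)$, where $\ell$ is the number of inversions. Let $W(\Omega)$ be the set of lacing diagrams in $\Omega^\circ$ for which $|\mathbf w|$ is minimal among all lacing diagrams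 in $\Omega^\circ$. Then for every $\mathbf w\in W(\Omega)$, $$|\mathbf w|=\operatorname{codim}\Omega .$$ -/

import Mathlib

namespace BipartiteA

/-! ### Permutations, partial permutations and completions -/

/-- The length of a permutation: its number of inversions. -/
def length {m : ℕ} (v : Equiv.Perm (Fin m)) : ℕ :=
  (Finset.univ.filter fun p : Fin m × Fin m => p.1 < p.2 ∧ v p.2 < v p.1).card

/-- The `k × l` partial permutation matrix `w` is the northwest corner of the matrix of the
permutation `v ∈ S_m` (the matrix having its `1`s at the positions `(i, v i)`). -/
def IsNWCorner {k l m : ℕ} (w : Fin k ≃. Fin l) (v : Equiv.Perm (Fin m)) : Prop :=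
  ∃ (hk : k ≤ m) (hl : l ≤ m), ∀ (i : Fin k) (j : Fin l),
    v (Fin.castLE hk i) = Fin.castLE hl j ↔ j ∈ w i

/-- `v` is the completion of `w`: among the permutation matrices with northwest corner `w` it has
the smallest possible size and, for that size, the smallest possible length. -/
def IsCompletion {k l : ℕ} (w : Fin k ≃. Fin l) (v : Σ m : ℕ, Equiv.Perm (Fin m)) : Prop :=
  IsNWCorner w v.2 ∧
  (∀ (m : ℕ) (u : Equiv.Perm (Fin m)), IsNWCorner w u → v.1 ≤ m) ∧
  (∀ u : Equiv.Perm (Fin v.1), IsNWCorner w u → length v.2 ≤ length u)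

/-- Some permutation has `w` as its northwest corner. -/
theorem exists_isNWCorner {k l : ℕ} (w : Fin k ≃. Fin l) :
    ∃ (m : ℕ) (v : Equiv.Perm (Fin m)), IsNWCorner w v := by
  classical
  let f : Fin k → Fin (l + k) := fun i =>
    match w i with
    | some j => Fin.castAdd k j
    | none => Fin.natAdd l i
  have hfs : ∀ i j, w i = some j → f i = Fin.castAdd k j := fun i j h => by simp [f, h]
  have hfn : ∀ i, w i = none → f i = Fin.natAdd l i := fun i h => by simp [f, h]
  have hf : Function.Injective f := by
    intro i i' h
    rcases hi : w i with _ | j <;> rcases hi' : w i' with _ | j'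
    · rw [hfn i hi, hfn i' hi'] at h
      exact Fin.natAdd_injective _ _ h
    · rw [hfn i hi, hfs i' j' hi'] at h
      have := congrArg Fin.val h
      simp at this
      omega
    · rw [hfs i j hi, hfn i' hi'] at h
      have := congrArg Fin.val h
      simp at this
      omega
    · rw [hfs i j hi, hfs i' j' hi'] at h
      have hj : j = j' := Fin.castAdd_injective _ _ h
      subst hj
      exact w.inj hi hi'
  have hc : Function.Injective (Fin.castLE (Nat.le_add_left k l)) := Fin.castLE_injective _
  let e : {x // x ∈ Set.range (Fin.castLE (Nat.le_add_left k l))} ≃ {x // x ∈ Set.range f} :=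
    (Equiv.ofInjective _ hc).symm.trans (Equiv.ofInjective f hf)
  refine ⟨l + k, e.extendSubtype, Nat.le_add_left k l, Nat.le_add_right l k, fun i j => ?_⟩
  have h1 : e.extendSubtype (Fin.castLE (Nat.le_add_left k l) i) = f i := by
    rw [Equiv.extendSubtype_apply_of_mem _ _ ⟨i, rfl⟩]
    have : (Equiv.ofInjective _ hc).symm ⟨Fin.castLE (Nat.le_add_left k l) i, ⟨i, rfl⟩⟩ = i :=
      Equiv.ofInjective_symm_apply hc i
    simp [e, this]
  rw [h1]
  rcases hi : w i with _ | j'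
  · rw [hfn i hi]
    refine ⟨fun h => ?_, fun h => by simp at h⟩
    have := congrArg Fin.val h
    simp at this
    omega
  · rw [hfs i j' hi]
    constructor
    · intro h
      have := congrArg Fin.val h
      simp only [Fin.val_castAdd, Fin.val_castLE] at this
      rw [Fin.ext this]
      rfl
    · intro h
      rw [Option.mem_some_iff] at h
      subst h
      rfl

/-- Every partial permutation has a completion. -/
theorem exists_isCompletion {k l : ℕ} (w : Fin k ≃. Fin l) : ∃ v, IsCompletion w v := by
  classical
  have h := exists_isNWCorner w
  obtain ⟨v, hv, hmin⟩ := Set.exists_min_image {u | IsNWCorner w u}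
    (length (m := Nat.find h)) (Set.toFinite _) (Nat.find_spec h)
  exact ⟨⟨Nat.find h, v⟩, hv, fun m u hu => Nat.find_min' h ⟨u, hu⟩, hmin⟩

/-- The completion `c(w)` of a partial permutation. -/
noncomputable def completion {k l : ℕ} (w : Fin k ≃. Fin l) : Σ m : ℕ, Equiv.Perm (Fin m) :=
  Classical.choose (exists_isCompletion w)

/-- The rotation by 180 degrees of a partial permutation matrix. -/
def rot {k l : ℕ} (w : Fin k ≃. Fin l) : Fin k ≃. Fin l :=
  (Fin.revPerm.toPEquiv.trans w).trans Fin.revPerm.toPEquiv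

/-- The rotation by 180 degrees of a permutation matrix. -/
def rotPerm {m : ℕ} (v : Equiv.Perm (Fin m)) : Equiv.Perm (Fin m) :=
  (Fin.revPerm.trans v).trans Fin.revPerm

/-! ### The bipartite type `A` quiver and its representation space -/

/-- The vertices of the bipartite quiver `y_n → x_n ← y_{n-1} → ⋯ → x_1 ← y_0`
(drawn from left to right): the sources are `y 0, …, y n`, and `x i` (`i = 0, …, n - 1`) is the sink `x_{i+1}`. -/
inductive Vertex (n : ℕ) : Type
  | y (i : Fin (n + 1)) : Vertex n
  | x (i : Fin n) : Vertex n

/-- The arrows: `α i` is the left-pointing arrow `α_{i+1} : y_i → x_{i+1}` and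
`β i` is the right-pointing arrow `β_{i+1} : y_{i+1} → x_{i+1}`. -/
inductive Arrow (n : ℕ) : Type
  | α (i : Fin n) : Arrow n
  | β (i : Fin n) : Arrow n
  deriving Fintype

/-- The tail `ta` of an arrow. -/
def Arrow.tail {n : ℕ} : Arrow n → Vertex n
  | .α i => .y i.castSucc
  | .β i => .y i.succ

/-- The head `ha` of an arrow. -/
def Arrow.head {n : ℕ} : Arrow n → Vertex n
  | .α i => .x i
  | .β i => .x i

/-- The representation space `rep_Q(d)` over `K`. -/
abbrev Rep {n : ℕ} (d : Vertex n → ℕ) (K : Type*) : Type _ :=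
  (a : Arrow n) → Matrix (Fin (d a.tail)) (Fin (d a.head)) K

/-- The group `GL(d)`. -/
abbrev GLd {n : ℕ} (d : Vertex n → ℕ) (K : Type*) [Field K] : Type _ :=
  (z : Vertex n) → Matrix.GeneralLinearGroup (Fin (d z)) K

/-- The right action `(V • g)_a = g_{ta}⁻¹ V_a g_{ha}`. -/
def act {n : ℕ} {d : Vertex n → ℕ} {K : Type*} [Field K] (V : Rep d K) (g : GLd d K) : Rep d K :=
  fun a => (((g a.tail)⁻¹ : Matrix.GeneralLinearGroup (Fin (d a.tail)) K) :
      Matrix (Fin (d a.tail)) (Fin (d a.tail)) K) * V a *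
    (g a.head : Matrix (Fin (d a.head)) (Fin (d a.head)) K)

/-- The `GL(d)`-orbit of a representation. -/
def orbit {n : ℕ} {d : Vertex n → ℕ} {K : Type*} [Field K] (V : Rep d K) : Set (Rep d K) :=
  Set.range (act V)

/-- Extension of scalars of a representation. -/
def baseChange {n : ℕ} {d : Vertex n → ℕ} {K : Type*} [Field K] (L : Type*) [Field L] [Algebra K L]
    (V : Rep d K) : Rep d L :=
  fun a => (V a).map (algebraMap K L)

/-- The index set of the coordinates of `rep_Q(d)`: the entries of all the matrices. -/
abbrev Coord {n : ℕ} (d : Vertex n → ℕ) : Type :=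
  Σ a : Arrow n, Fin (d a.tail) × Fin (d a.head)

/-- The coordinate vector of a representation, a point of affine space. -/
def coords {n : ℕ} {d : Vertex n → ℕ} {L : Type*} (V : Rep d L) : Coord d → L :=
  fun c => V c.1 c.2.1 c.2.2

/-- The Zariski closure of a set of `L`-points of `rep_Q(d)`, the closed sets being those which are
defined by polynomials over `K`. For `L = K` this is the usual Zariski closure. -/
def zariskiClosure {n : ℕ} {d : Vertex n → ℕ} (K : Type*) {L : Type*} [Field K] [Field L]
    [Algebra K L] (Z : Set (Rep d L)) : Set (Rep d L) :=
  coords ⁻¹' MvPolynomial.zeroLocus L (MvPolynomial.vanishingIdeal K (coords '' Z))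

/-- The quiver locus of `V`: the closure of its `GL(d)`-orbit, as a set of `L`-points.
For an infinite field `K` one can take `L = K`; for a finite field `K` the `K`-points do
not see the closure, and `L` can be an algebraic closure of `K`. -/
def quiverLocus {n : ℕ} {d : Vertex n → ℕ} {K : Type*} (L : Type*) [Field K] [Field L]
    [Algebra K L] (V : Rep d K) : Set (Rep d L) :=
  zariskiClosure K (orbit (baseChange L V))

/-- The codimension of a closed subset of `rep_Q(d)`: the height of its ideal in the
coordinate ring `K[rep_Q(d)]`. -/
noncomputable def codim {n : ℕ} {d : Vertex n → ℕ} (K : Type*) {L : Type*} [Field K] [Field L]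
    [Algebra K L] (Z : Set (Rep d L)) : ℕ∞ :=
  (MvPolynomial.vanishingIdeal K (coords '' Z)).height

/-! ### Lacing diagrams -/

/-- A lacing diagram: a partial permutation for every arrow, where `j ∈ w a i` means that there is
an arrow from the `i`-th dot of column `ta` to the `j`-th dot of column `ha`. -/
abbrev LacingDiagram {n : ℕ} (d : Vertex n → ℕ) : Type :=
  (a : Arrow n) → Fin (d a.tail) ≃. Fin (d a.head)

namespace LacingDiagram

variable {n : ℕ} {d : Vertex n → ℕ}

/-- The representation given by the partial permutation matrices of a lacing diagram. -/
def toRep (K : Type*) [Field K] (w : LacingDiagram d) : Rep d K :=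
  fun a => (w a).toMatrix

/-- The extended lacing diagram: `c(w_a)` for right-pointing `a`, and `rot(c(rot(w_a)))` for
left-pointing `a`. -/
noncomputable def extended (w : LacingDiagram d) : Arrow n → Σ m : ℕ, Equiv.Perm (Fin m)
  | .α i => ⟨(completion (rot (w (.α i)))).1, rotPerm (completion (rot (w (.α i)))).2⟩
  | .β i => completion (w (.β i))

/-- The length `|w|`: the number of crossings of the extended lacing diagram. Two arrows between
the same two columns cross exactly when they form an inversion. -/
noncomputable def crossings (w : LacingDiagram d) : ℕ :=
  ∑ a : Arrow n, length (w.extended a).2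

/-- `w` is a minimal lacing diagram of the orbit of `V`. -/
def IsMinimal {K : Type*} [Field K] (V : Rep d K) (w : LacingDiagram d) : Prop :=
  w.toRep K ∈ orbit V ∧
    ∀ w' : LacingDiagram d, w'.toRep K ∈ orbit V → w.crossings ≤ w'.crossings

end LacingDiagram

end BipartiteA

/-! Both numbers equal the corank of the differential D : A ↦ (V_a A_{ha} - A_{ta} V_a)_a of the
orbit map at the identity.

Geometry: the dimension of Ω is the rank of D, in every characteristic, because the stabilizer of V
consists of the units of the linear space End(V) = ker D. Algebraically, the ideal of Ω is the
kernel of the comorphism `orbitMap` (`vanishingIdeal_orbit`). The transcendence degree of the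
quotient is at least rank D by following curves 1 + tS through the identity
(`algebraicIndependent_coords`), and at most rank D because an endomorphism of V moves the generic
group element into an affine slice with rank D free coordinates (`trdeg_quotient_le`). As height is
the number of variables minus transcendence degree, `codim_quiverLocus_eq_corank` follows.

Combinatorics: for V a lacing diagram w, every coordinate of D is up to sign a difference of at most
two matrix entries. Coordinates of the target and matrix entries thus form disjoint chains, and the
corank of D is the number of chains with both ends in the target. By Rothe diagrams, |w| counts the
target coordinates at which the order of the two neighbouring pairs of dots changes in a prescribed
way (`crossings_eq_ncard`). A chain with both ends in the target always contains such a change, so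
corank D ≤ |w| (`card_coord_le`). After sorting the laces by the positions of their ends, every
crossing is the lower end of such a chain, so some w' in the same orbit has |w'| ≤ corank D
(`exists_crossings_add_le`). For minimal w, corank D ≤ |w| ≤ |w'| ≤ corank D. -/

/-! ### Heights of prime ideals in polynomial rings -/

open MvPolynomial in
/-- Every maximal ideal of a polynomial ring in `m` variables over a field has height `m`. -/
theorem MvPolynomial.height_of_isMaximal {F ι : Type*} [Field F] [Finite ι]
    (m : Ideal (MvPolynomial ι F)) [hm : m.IsMaximal] : m.height = Nat.card ι := by
  induction ι using Finite.induction_empty_option with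
  | of_equiv e H =>
    have h1 : (m.comap (renameEquiv F e).toRingEquiv).IsMaximal :=
      Ideal.comap_isMaximal_of_equiv (renameEquiv F e).toRingEquiv
    have := H (m.comap (renameEquiv F e).toRingEquiv)
    rw [← Nat.card_congr e, ← this]
    exact ((renameEquiv F e).toRingEquiv.height_comap m).symm
  | h_empty =>
    have : m = ⊥ := by
      have h : IsField (MvPolynomial PEmpty F) :=
        (isEmptyRingEquiv F PEmpty).toMulEquiv.isField (Field.toIsField F)
      let _ := h.toField
      exact (Ideal.eq_bot_or_top m).resolve_right (Ideal.IsPrime.ne_top')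
    subst this
    simp
  | @h_option ι _ IH =>
    let e := (optionEquivLeft F ι).toRingEquiv
    have h1 : (m.comap e.symm).IsMaximal := Ideal.comap_isMaximal_of_equiv e.symm
    -- A field polynomial ring is Jacobson, so the contraction along `C` stays maximal and the
    -- induction applies to it; the last variable adds one to the height.
    have h2 : ((m.comap e.symm).comap (Polynomial.C : _ →+* _)).IsMaximal :=
      Polynomial.isMaximal_comap_C_of_isJacobsonRing _
    have h3 : (m.comap e.symm).LiesOver ((m.comap e.symm).comap (Polynomial.C : _ →+* _)) := ⟨rfl⟩
    have := Polynomial.height_eq_height_add_one ((m.comap e.symm).comap (Polynomial.C : _ →+* _))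
      (m.comap e.symm)
    rw [IH, e.symm.height_comap] at this
    rw [this]
    simp

theorem MvPolynomial.isIntegral_of_surjective {F τ B : Type*} [CommRing F] [CommRing B]
    [Algebra F B] (g : MvPolynomial τ F →ₐ[F] B) (hg : Function.Surjective g)
    (hX : ∀ j, IsIntegral F (g (X j))) : Algebra.IsIntegral F B := by
  refine ⟨fun x => ?_⟩
  obtain ⟨x, rfl⟩ := hg x
  induction x using MvPolynomial.induction_on with
  | C a =>
    have : g (C a) = algebraMap F B a := g.commutes a
    rw [this]
    exact isIntegral_algebraMap
  | add p q hp hq => rw [map_add]; exact hp.add hq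
  | mul_X p j hp => rw [map_mul]; exact hp.mul (hX j)

attribute [local instance] MvPolynomial.algebraMvPolynomial in
open MvPolynomial in
/-- A prime ideal `P` of `R[τ]`, `R` a domain, which meets `R` in zero and over which every variable
is algebraic, has height the number of variables. -/
theorem MvPolynomial.height_of_isAlgebraic {R τ : Type*} (F : Type*) [CommRing R] [IsDomain R]
    [Field F] [Algebra R F] [IsFractionRing R F] [Finite τ]
    (P : Ideal (MvPolynomial τ R)) [P.IsPrime] (h0 : ∀ r : R, C r ∈ P → r = 0)
    (halg : ∀ j : τ, IsAlgebraic R (Ideal.Quotient.mk P (X j))) : P.height = Nat.card τ := by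
  let M := (nonZeroDivisors R).map (C (σ := τ))
  have hdisj : Disjoint (M : Set (MvPolynomial τ R)) (P : Set _) := by
    rw [Set.disjoint_left]
    rintro _ ⟨r, hr, rfl⟩ h
    exact nonZeroDivisors.ne_zero hr (h0 r h)
  -- Inverting the nonzero constants, which `P` avoids, preserves the height. Over the field `F` the
  -- quotient becomes integral, hence a field, so the extended ideal is maximal.
  rw [← IsLocalization.height_map_of_disjoint (S := MvPolynomial τ F) M P hdisj]
  let Q := P.map (algebraMap (MvPolynomial τ R) (MvPolynomial τ F))
  have hQ : Q.IsPrime := IsLocalization.isPrime_of_isPrime_disjoint M _ P ‹_› hdisj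
  have hint : Algebra.IsIntegral F (MvPolynomial τ F ⧸ Q) := by
    have hX : ∀ j : τ, IsIntegral F (Ideal.Quotient.mk Q (X j)) := by
      intro j
      obtain ⟨p, hp, hpj⟩ := halg j
      rw [← isAlgebraic_iff_isIntegral]
      refine ⟨p.map (algebraMap R F), ?_, ?_⟩
      · rwa [Ne, Polynomial.map_eq_zero_iff (IsFractionRing.injective R F)]
      · have h1 : Polynomial.aeval (X j : MvPolynomial τ R) p ∈ P := by
          rw [← Ideal.Quotient.eq_zero_iff_mem]
          have := Polynomial.aeval_algHom_apply (Ideal.Quotient.mkₐ R P) (X j) p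
          exact this.symm.trans hpj
        have h2 := Ideal.mem_map_of_mem (algebraMap (MvPolynomial τ R) (MvPolynomial τ F)) h1
        have h3 : algebraMap (MvPolynomial τ R) (MvPolynomial τ F) (Polynomial.aeval (X j) p) =
            Polynomial.aeval (X j : MvPolynomial τ F) (p.map (algebraMap R F)) := by
          rw [Polynomial.aeval_def, Polynomial.hom_eval₂, Polynomial.aeval_def,
            Polynomial.eval₂_map]
          congr 1
          · ext1 r
            exact map_C _ r
          · exact map_X _ j
        rw [h3] at h2
        have := Polynomial.aeval_algHom_apply (Ideal.Quotient.mkₐ F Q) (X j) (p.map (algebraMap R F))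
        exact this.trans (Ideal.Quotient.eq_zero_iff_mem.2 h2)
    exact isIntegral_of_surjective (B := MvPolynomial τ F ⧸ Q) (Ideal.Quotient.mkₐ F Q) (Ideal.Quotient.mkₐ_surjective F Q) hX
  have hmax : Q.IsMaximal := by
    rw [Ideal.Quotient.maximal_ideal_iff_isField_quotient]
    exact isField_of_isIntegral_of_isField' (R := F) (S := MvPolynomial τ F ⧸ Q)
      (Field.toIsField F)
  exact height_of_isMaximal Q

open MvPolynomial in
theorem MvPolynomial.aeval_mk_X {K σ : Type*} [CommRing K] (P : Ideal (MvPolynomial σ K))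
    (J : Set σ) (r : MvPolynomial J K) :
    aeval (fun j : J => Ideal.Quotient.mk P (X (j : σ))) r =
      Ideal.Quotient.mk P (rename (↑) r) := by
  induction r using MvPolynomial.induction_on with
  | C a => simp; rfl
  | add p q hp hq => simp only [map_add, hp, hq]
  | mul_X p j hp => simp only [map_mul, hp, aeval_X, rename_X]

open MvPolynomial in
/-- If the classes of the variables in `J` form a transcendence basis of `K[σ] ⧸ P`, then the height
of `P` is the number of the other variables. -/
theorem MvPolynomial.height_of_isTranscendenceBasis {K σ : Type*} [Field K] [Finite σ]
    (P : Ideal (MvPolynomial σ K)) [P.IsPrime] (J : Set σ)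
    (hJ : IsTranscendenceBasis K fun j : J => Ideal.Quotient.mk P (X (j : σ))) :
    P.height = Nat.card (Jᶜ : Set σ) := by
  classical
  -- The variables outside `J` are regarded as variables over the domain `K[J]`, which meets `P` in
  -- zero by independence.
  let e : MvPolynomial (Jᶜ : Set σ) (MvPolynomial J K) ≃ₐ[K] MvPolynomial σ K :=
    (sumAlgEquiv K _ _).symm.trans (renameEquiv K ((Equiv.sumComm _ _).trans (Equiv.Set.sumCompl J)))
  have heC : ∀ r : MvPolynomial J K, e (C r) = rename (↑) r := by
    intro r
    induction r using MvPolynomial.induction_on with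
    | C a => simp [e]
    | add p q hp hq => simp [hp, hq]
    | mul_X p j hp =>
      rw [C_mul, map_mul, hp, map_mul]
      simp [e]
  rw [← e.toRingEquiv.height_comap P]
  have : (P.comap e.toRingEquiv).IsPrime := Ideal.comap_isPrime _ _
  apply height_of_isAlgebraic (FractionRing (MvPolynomial J K))
  · intro r hr
    have h1 : rename (↑) r ∈ P := by rw [← heC]; exact hr
    apply hJ.1
    rw [map_zero, ← Ideal.Quotient.eq_zero_iff_mem.2 h1]
    exact aeval_mk_X P J r
  · intro j
    have halg := hJ.isAlgebraic
    let g : (MvPolynomial (Jᶜ : Set σ) (MvPolynomial J K) ⧸ P.comap e.toRingEquiv) →+*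
        (MvPolynomial σ K ⧸ P) := Ideal.quotientMap P (e.toRingEquiv : _ →+* _) le_rfl
    have hg : Function.Injective g := Ideal.quotientMap_injective
    refine IsAlgebraic.of_ringHom_of_comp_eq (hJ.1.aevalEquiv : MvPolynomial J K →+* _) g
      (halg.isAlgebraic _) hJ.1.aevalEquiv.surjective hg ?_
    refine RingHom.ext fun r => ?_
    have h1 := hJ.1.algebraMap_aevalEquiv r
    have h2 : g (Ideal.Quotient.mk _ (C r)) = Ideal.Quotient.mk P (e (C r)) := rfl
    rw [heC, ← aeval_mk_X] at h2
    exact h1.trans h2.symm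

/-! ### Algebraic independence from first-order terms -/

open scoped Polynomial in
-- A monomial of degree e becomes divisible by t^e, and its coefficient at t^e depends only on the
-- constant terms of the `v j`. Hence the lowest possible power of t sees exactly the lowest
-- homogeneous part.
theorem Polynomial.coeff_aeval_X_mul {K J : Type*} [CommRing K]
    (v : J → (MvPolynomial J K)[X]) (hv : ∀ j, (v j).coeff 0 = MvPolynomial.X j)
    (q : MvPolynomial J K) (k : ℕ) (hk : ∀ s ∈ q.support, k ≤ s.degree) :
    (MvPolynomial.aeval (fun j => X * v j) q).coeff k = MvPolynomial.homogeneousComponent k q := by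
  classical
  have hmon : ∀ (s : J →₀ ℕ) (a : K), k ≤ s.degree →
      (MvPolynomial.aeval (fun j => X * v j) (MvPolynomial.monomial s a)).coeff k =
        if s.degree = k then MvPolynomial.monomial s a else 0 := by
    intro s a hs
    have h1 : MvPolynomial.aeval (fun j => X * v j) (MvPolynomial.monomial s a) =
        X ^ s.degree * (C (MvPolynomial.C a) * s.prod fun j e => v j ^ e) := by
      rw [MvPolynomial.aeval_monomial]
      simp only [mul_pow, Finsupp.prod_mul]
      have : (s.prod fun _ e => (X : (MvPolynomial J K)[X]) ^ e) = X ^ s.degree := by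
        rw [Finsupp.prod, Finset.prod_pow_eq_pow_sum]
        rfl
      rw [this]
      have h2 : algebraMap K (MvPolynomial J K)[X] a = C (MvPolynomial.C a) := rfl
      rw [h2]
      ring
    rw [h1, coeff_X_pow_mul']
    rcases hs.eq_or_lt with h | h
    · rw [if_pos h.ge, if_pos h.symm, h, Nat.sub_self, coeff_zero_eq_eval_zero, eval_mul, eval_C]
      rw [Finsupp.prod, eval_prod, MvPolynomial.monomial_eq]
      congr 1
      refine Finset.prod_congr rfl fun j _ => ?_
      rw [eval_pow, ← coeff_zero_eq_eval_zero, hv]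
    · rw [if_neg (by omega), if_neg (by omega)]
  conv_lhs => rw [q.as_sum]
  rw [MvPolynomial.homogeneousComponent_apply, map_sum, finsetSum_coeff, Finset.sum_filter]
  exact Finset.sum_congr rfl fun s hs => hmon s _ (hk s hs)

open scoped Polynomial in
/-- Polynomials `a_j + t X_j + O(t²)` in `t` are algebraically independent. -/
theorem Polynomial.eq_zero_of_aeval_eq_zero {K J : Type*} [CommRing K] (a : J → K)
    (y : J → (MvPolynomial J K)[X]) (p : MvPolynomial J K)
    (hp : MvPolynomial.aeval
      (fun j => algebraMap K _ (a j) + X * (C (MvPolynomial.X j) + X * y j)) p = 0) : p = 0 := by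
  -- Translation by `a` removes the constant terms, so that every argument becomes divisible by t.
  let q : MvPolynomial J K := MvPolynomial.aeval (fun j => MvPolynomial.X j + MvPolynomial.C (a j)) p
  have hpq : MvPolynomial.aeval (fun j => MvPolynomial.X j - MvPolynomial.C (a j)) q = p := by
    simp only [q]
    rw [← AlgHom.comp_apply]
    have : (MvPolynomial.aeval (R := K) fun j => (MvPolynomial.X j - MvPolynomial.C (a j) : MvPolynomial J K)).comp
        (MvPolynomial.aeval fun j => MvPolynomial.X j + MvPolynomial.C (a j)) = AlgHom.id K _ := by
      ext j : 1
      simp [MvPolynomial.algebraMap_eq]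
    rw [this]; rfl
  have hq : MvPolynomial.aeval (fun j => X * (C (MvPolynomial.X j) + X * y j)) q = 0 := by
    rw [← hp]
    simp only [q]
    rw [← AlgHom.comp_apply]
    congr 1
    ext j : 1
    simp only [AlgHom.comp_apply, MvPolynomial.aeval_X, map_add]
    rw [add_comm]
    congr 1
    exact MvPolynomial.aeval_C _ _
  have hq0 : q = 0 := by
    by_contra hne
    -- A monomial of least degree would survive in the coefficient of that power of t.
    obtain ⟨s, hs, hmin⟩ := Finset.exists_min_image q.support (fun s => s.degree)
      (MvPolynomial.support_nonempty.2 hne)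
    have h := Polynomial.coeff_aeval_X_mul (fun j => C (MvPolynomial.X j) + X * y j)
      (by simp) q s.degree hmin
    rw [hq, coeff_zero] at h
    have h2 := congrArg (MvPolynomial.coeff s) h
    rw [MvPolynomial.coeff_homogeneousComponent, if_pos rfl] at h2
    exact MvPolynomial.mem_support_iff.1 hs (by simpa using h2.symm)
  rw [← hpq, hq0, map_zero]

/-! ### The orbit map and the ideal of the orbit -/

namespace BipartiteA

variable {n : ℕ} {d : Vertex n → ℕ}

/-- The vertices are indexed by `Fin (n + 1) ⊕ Fin n`. -/
def Vertex.equivSum (n : ℕ) : Vertex n ≃ Fin (n + 1) ⊕ Fin n where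
  toFun | .y i => .inl i
        | .x i => .inr i
  invFun | .inl i => .y i
         | .inr i => .x i
  left_inv := by rintro (_ | _) <;> rfl
  right_inv := by rintro (_ | _) <;> rfl

instance : DecidableEq (Vertex n) := (Vertex.equivSum n).decidableEq

instance : Fintype (Vertex n) := Fintype.ofEquiv _ (Vertex.equivSum n).symm

/-- The product of the matrix rings `Mat(d(z))` over all vertices. -/
abbrev Gl (d : Vertex n → ℕ) (A : Type*) : Type _ :=
  (z : Vertex n) → Matrix (Fin (d z)) (Fin (d z)) A

/-- The index set of the entries of an element of `Gl d A`. -/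
abbrev GlIndex (d : Vertex n → ℕ) : Type :=
  Σ z : Vertex n, Fin (d z) × Fin (d z)

/-- The representation `(h_{ta} V_a h_{ha})_a`. -/
def twist {K A : Type*} [CommRing K] [CommRing A] [Algebra K A] (V : Rep d K) (h : Gl d A) :
    Rep d A :=
  fun a => h a.tail * (V a).map (algebraMap K A) * h a.head

/-- Every source is inverted, every sink is left unchanged. -/
def invSources {K : Type*} [Field K] (g : GLd d K) : GLd d K
  | .y i => (g (.y i))⁻¹
  | .x i => g (.x i)

theorem act_baseChange {K L : Type*} [Field K] [Field L] [Algebra K L] (V : Rep d K)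
    (g : GLd d L) :
    act (baseChange L V) g = twist V fun z => (invSources g z : Matrix _ _ L) := by
  funext a
  cases a <;> rfl

/-- Inversion at the sources permutes the group, so the orbit is also the image of a map that is
polynomial in the matrix entries, without denominators. -/
theorem mem_orbit_baseChange {K L : Type*} [Field K] [Field L] [Algebra K L] (V : Rep d K)
    (U : Rep d L) :
    U ∈ orbit (baseChange L V) ↔ ∃ g : GLd d L, U = twist V fun z => (g z : Matrix _ _ L) := by
  constructor
  · rintro ⟨g, rfl⟩
    exact ⟨_, act_baseChange V g⟩
  · rintro ⟨g, rfl⟩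
    refine ⟨invSources g, ?_⟩
    rw [act_baseChange]
    congr 1
    funext z
    cases z <;> simp [invSources]

theorem coords_twist_map {K A B : Type*} [CommRing K] [CommRing A] [Algebra K A] [CommRing B]
    [Algebra K B] (V : Rep d K) (h : Gl d A) (f : A →ₐ[K] B) (c : Coord d) :
    f (coords (twist V h) c) = coords (twist V fun z => (h z).map f) c := by
  have : (twist V h c.1).map f = twist V (fun z => (h z).map f) c.1 := by
    simp only [twist]
    rw [Matrix.map_mul, Matrix.map_mul, Matrix.map_map]
    congr 3
    funext x
    exact f.commutes x
  exact congrFun (congrFun this c.2.1) c.2.2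

/-- The matrices of indeterminates. -/
noncomputable def generic (d : Vertex n → ℕ) (K : Type*) [CommRing K] :
    Gl d (MvPolynomial (GlIndex d) K) :=
  fun z => Matrix.of fun i j => MvPolynomial.X ⟨z, i, j⟩

theorem generic_map {K A : Type*} [CommRing K] [CommRing A] [Algebra K A] (x : GlIndex d → A)
    (z : Vertex n) :
    (generic d K z).map (MvPolynomial.aeval (R := K) x) = Matrix.of fun i j => x ⟨z, i, j⟩ := by
  ext i j
  simp [generic]

/-- The comorphism of the orbit map of `V`. -/
noncomputable def orbitMap {K : Type*} [CommRing K] (V : Rep d K) :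
    MvPolynomial (Coord d) K →ₐ[K] MvPolynomial (GlIndex d) K :=
  MvPolynomial.aeval (coords (twist V (generic d K)))

/-- The algebra `A` is arbitrary because the identity is used both at `L`-points and along curves
with polynomial entries. -/
theorem aeval_orbitMap {K A : Type*} [CommRing K] [CommRing A] [Algebra K A] (V : Rep d K)
    (h : Gl d A) (p : MvPolynomial (Coord d) K) :
    MvPolynomial.aeval (fun g : GlIndex d => h g.1 g.2.1 g.2.2) (orbitMap V p) =
      MvPolynomial.aeval (coords (twist V h)) p := by
  rw [orbitMap, ← AlgHom.comp_apply]
  congr 1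
  ext c
  simp only [AlgHom.comp_apply, MvPolynomial.aeval_X]
  rw [coords_twist_map]
  congr 2
  funext z
  rw [generic_map]
  rfl

/-- The product of the determinants of the generic matrices. -/
noncomputable def genericDet (d : Vertex n → ℕ) (K : Type*) [CommRing K] :
    MvPolynomial (GlIndex d) K :=
  ∏ z, (generic d K z).det

theorem aeval_genericDet {K A : Type*} [CommRing K] [CommRing A] [Algebra K A] (h : Gl d A) :
    MvPolynomial.aeval (fun g : GlIndex d => h g.1 g.2.1 g.2.2) (genericDet d K) =
      ∏ z, (h z).det := by
  rw [genericDet, map_prod]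
  refine Finset.prod_congr rfl fun z _ => ?_
  rw [AlgHom.map_det, AlgHom.mapMatrix_apply, generic_map]
  rfl

theorem genericDet_ne_zero {K : Type*} [Field K] : genericDet d K ≠ 0 := by
  intro h
  have := aeval_genericDet (K := K) (1 : Gl d K)
  rw [h, map_zero] at this
  simp at this

/-- If `p` vanishes on the orbit, the pullback of `p` times `genericDet` vanishes at all tuples of
matrices over `L`: at invertible ones by the first factor, at the others by the second. As `L` is
infinite the product is zero, and `genericDet` is not. -/
theorem vanishingIdeal_orbit {K L : Type*} [Field K] [Field L] [Algebra K L] [Infinite L]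
    (V : Rep d K) :
    MvPolynomial.vanishingIdeal K (coords '' orbit (baseChange L V)) =
      RingHom.ker (orbitMap V) := by
  ext p
  rw [MvPolynomial.mem_vanishingIdeal_iff, RingHom.mem_ker]
  constructor
  · intro h
    suffices h0 : orbitMap V p * genericDet d K = 0 from
      (mul_eq_zero.1 h0).resolve_right genericDet_ne_zero
    apply MvPolynomial.map_injective (algebraMap K L) (algebraMap K L).injective
    rw [map_zero]
    apply MvPolynomial.funext
    intro x
    rw [map_zero, MvPolynomial.eval_map, ← MvPolynomial.aeval_def]
    let H : Gl d L := fun z => Matrix.of fun i j => x ⟨z, i, j⟩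
    have hx : x = fun g : GlIndex d => H g.1 g.2.1 g.2.2 := rfl
    rw [map_mul, hx, aeval_orbitMap, aeval_genericDet]
    by_cases hdet : ∀ z, IsUnit (H z)
    · rw [h (coords (twist V H)) ⟨_, (mem_orbit_baseChange V _).2 ⟨fun z => (hdet z).unit, rfl⟩, rfl⟩,
        zero_mul]
    · push Not at hdet
      obtain ⟨z, hz⟩ := hdet
      rw [Matrix.isUnit_iff_isUnit_det, isUnit_iff_ne_zero, not_not] at hz
      rw [Finset.prod_eq_zero (Finset.mem_univ z) hz, mul_zero]
  · rintro h _ ⟨U, hU, rfl⟩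
    obtain ⟨g, rfl⟩ := (mem_orbit_baseChange V U).1 hU
    rw [← aeval_orbitMap, h, map_zero]

theorem codim_quiverLocus {K L : Type*} [Field K] [Field L] [Algebra K L] [Infinite L]
    (V : Rep d K) : codim K (quiverLocus L V) = (RingHom.ker (orbitMap V)).height := by
  have hsurj : Function.Surjective (coords : Rep d L → Coord d → L) := fun f =>
    ⟨fun a i j => f ⟨a, i, j⟩, rfl⟩
  rw [codim, quiverLocus, zariskiClosure, Set.image_preimage_eq _ hsurj, ← vanishingIdeal_orbit (L := L)]
  congr 1
  -- A set and its closure have the same vanishing ideal.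
  exact (MvPolynomial.zeroLocus_vanishingIdeal_galoisConnection (k := K) (K := L)).u_l_u_eq_u
    (OrderDual.toDual (coords '' orbit (baseChange L V)))

end BipartiteA

/-! ### Linear algebra and transcendence degree tools -/

/-- A linear map `D` into a coordinate space has a right inverse on `rank D` of the coordinates. -/
theorem LinearMap.exists_coords_dual {K M σ : Type*} [Field K] [AddCommGroup M] [Module K M]
    [Finite σ] (D : M →ₗ[K] (σ → K)) :
    ∃ J : Set σ, Nat.card J = Module.finrank K (LinearMap.range D) ∧
      ∃ A : J → M, (∀ j : J, D (A j) j = 1) ∧ ∀ j j' : J, j ≠ j' → D (A j) j' = 0 := by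
  classical
  have := Fintype.ofFinite σ
  let mk := (LinearMap.range D).mkQ
  -- Some of the unit vectors form a basis of the cokernel; `J` consists of the coordinates left
  -- over.
  obtain ⟨κ, a, ha, hspan, hli⟩ :=
    exists_linearIndependent' K fun c : σ => mk (Pi.single c 1)
  have htop : Submodule.span K (Set.range fun c : σ => mk (Pi.single c 1)) = ⊤ := by
    have h1 : Submodule.span K (Set.range fun c : σ => (Pi.single c 1 : σ → K)) = ⊤ := by
      have := (Pi.basisFun K σ).span_eq
      convert this using 3
      ext c
      simp [Pi.basisFun_apply]
    have h2 : (Set.range fun c : σ => mk (Pi.single c 1)) =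
        mk '' Set.range fun c : σ => (Pi.single c 1 : σ → K) := by
      rw [← Set.range_comp]; rfl
    rw [h2, ← Submodule.map_span, h1, Submodule.map_top, Submodule.range_mkQ]
  rw [htop] at hspan
  have : Finite κ := Finite.of_injective a ha
  have := Fintype.ofFinite κ
  let b := Module.Basis.mk hli hspan.ge
  refine ⟨(Set.range a)ᶜ, ?_, ?_⟩
  · have h1 : Module.finrank K ((σ → K) ⧸ LinearMap.range D) = Nat.card κ := by
      rw [Module.finrank_eq_card_basis b, Nat.card_eq_fintype_card]
    have h2 := Submodule.finrank_quotient_add_finrank (LinearMap.range D)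
    have h3 : Nat.card κ = (Set.range a).ncard := by
      rw [← Set.image_univ, Set.ncard_image_of_injective _ ha, Set.ncard_univ]
    have h4 := Set.ncard_add_ncard_compl (Set.range a)
    rw [Module.finrank_fintype_fun_eq_card, ← Nat.card_eq_fintype_card] at h2
    rw [Nat.card_coe_set_eq]
    omega
  · have key : ∀ j : ((Set.range a)ᶜ : Set σ), ∃ x : M, ∀ j' : ((Set.range a)ᶜ : Set σ),
        D x j' = (Pi.single (j : σ) (1 : K) : σ → K) j' := by
      intro j
      -- Modulo the range, the unit vector at `j` is a combination `v` of unit vectors outside `J`.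
      -- Subtracting `v` lands in the range without changing the coordinates in `J`.
      let v : σ → K := ∑ k, b.repr (mk (Pi.single (j : σ) 1)) k • Pi.single (a k) (1 : K)
      have hv : mk v = mk (Pi.single (j : σ) 1) := by
        conv_rhs => rw [← b.sum_repr (mk (Pi.single (j : σ) 1))]
        simp only [v, map_sum, map_smul]
        refine Finset.sum_congr rfl fun k _ => ?_
        congr 1
        simp [b]
      have hmem : Pi.single (j : σ) 1 - v ∈ LinearMap.range D := by
        rw [← Submodule.ker_mkQ (LinearMap.range D), LinearMap.mem_ker, map_sub, sub_eq_zero]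
        exact hv.symm
      obtain ⟨x, hx⟩ := hmem
      refine ⟨x, fun j' => ?_⟩
      rw [hx]
      have : v j' = 0 := by
        simp only [v, Finset.sum_apply, Pi.smul_apply]
        refine Finset.sum_eq_zero fun k _ => ?_
        rw [Pi.single_eq_of_ne, smul_zero]
        rintro h
        exact j'.2 ⟨k, h.symm⟩
      rw [Pi.sub_apply, this, sub_zero]
    choose A hA using key
    refine ⟨A, fun j => by simp [hA], fun j j' h => ?_⟩
    rw [hA, Pi.single_eq_of_ne (by simpa [Subtype.ext_iff] using h.symm)]

/-- A domain inside a field generated by `ι` elements has transcendence degree at most `#ι`. -/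
theorem Algebra.trdeg_le_of_range_le_adjoin.{u} {K ι : Type*} {E B : Type u} [Field K] [Field E]
    [Algebra K E] [CommRing B] [Algebra K B] [Finite ι] (t : ι → E) (g : B →ₐ[K] E)
    (hg : Function.Injective g) (hrange : ∀ b, g b ∈ IntermediateField.adjoin K (Set.range t)) :
    Algebra.trdeg K B ≤ (Nat.card ι : Cardinal) := by
  let M := IntermediateField.adjoin K (Set.range t)
  let t' : ι → M := fun i => ⟨t i, IntermediateField.subset_adjoin _ _ ⟨i, rfl⟩⟩
  let g' : B →ₐ[K] M := g.codRestrict M.toSubalgebra hrange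
  have hg' : Function.Injective g' := fun x y h => hg (congrArg Subtype.val h)
  -- Elements of `M` are quotients of polynomials in the generators, and inverses of algebraic
  -- elements are algebraic.
  have halg : Algebra.IsAlgebraic (Algebra.adjoin K (Set.range t')) M := by
    have hmem : ∀ p : MvPolynomial ι K,
        IsAlgebraic (Algebra.adjoin K (Set.range t')) (MvPolynomial.aeval t' p) := by
      intro p
      have : MvPolynomial.aeval t' p ∈ Algebra.adjoin K (Set.range t') := by
        rw [Algebra.adjoin_range_eq_range_aeval]
        exact ⟨p, rfl⟩
      exact isAlgebraic_algebraMap (⟨_, this⟩ : Algebra.adjoin K (Set.range t'))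
    refine ⟨fun x => ?_⟩
    obtain ⟨r, s, hx⟩ := (IntermediateField.mem_adjoin_range_iff K t (x : E)).1 x.2
    have hval : ∀ p : MvPolynomial ι K, ((MvPolynomial.aeval t' p : M) : E) =
        MvPolynomial.aeval t p := fun p => by
      exact MvPolynomial.comp_aeval_apply (f := t') M.val p
    have : x = MvPolynomial.aeval t' r * (MvPolynomial.aeval t' s)⁻¹ := by
      apply Subtype.ext
      rw [hx, div_eq_mul_inv, ← hval, ← hval]
      rfl
    rw [this]
    exact (hmem r).mul (hmem s).inv
  have h1 : Algebra.trdeg K M ≤ Cardinal.mk (Set.range t') :=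
    Algebra.IsAlgebraic.trdeg_le_cardinalMk K (Set.range t')
  have h2 : Cardinal.mk (Set.range t') ≤ (Nat.card ι : Cardinal) := by
    rw [← Cardinal.lift_le, Cardinal.lift_natCast]
    refine Cardinal.mk_range_le_lift.trans ?_
    have := Fintype.ofFinite ι
    simp
  exact (trdeg_le_of_injective (R := K) g' hg').trans (h1.trans h2)

/-! ### The differential and the lower bound for the transcendence degree -/

namespace BipartiteA

variable {n : ℕ} {d : Vertex n → ℕ}

/-- The differential of the orbit map at the identity, `A ↦ (V_a A_{ha} - A_{ta} V_a)_a`. -/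
def infinitesimal {K : Type*} [Field K] (V : Rep d K) : Gl d K →ₗ[K] (Coord d → K) where
  toFun A := coords fun a => V a * A a.head - A a.tail * V a
  map_add' A B := by
    funext c
    simp only [coords, Pi.add_apply, Matrix.mul_add, Matrix.add_mul, Matrix.sub_apply,
      Matrix.add_apply]
    ring
  map_smul' k A := by
    funext c
    simp only [coords, Pi.smul_apply, Matrix.mul_smul, Matrix.smul_mul, Matrix.sub_apply,
      Matrix.smul_apply, smul_eq_mul, RingHom.id_apply]
    ring

open Polynomial in
-- Put S = ∑ X_j A_j and move `V` along the curve with first-order direction S. To first order in t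
-- the coordinate j in `J` changes by X_j, because the A_j are dual to these coordinates. A relation
-- among the coordinates on the orbit would thus be a relation among polynomials a_j + t X_j +
-- O(t²).
theorem algebraicIndependent_coords {K : Type*} [Field K] (V : Rep d K) (J : Set (Coord d))
    (A : J → Gl d K)
    (hA : ∀ j : J, infinitesimal V (A j) j = 1)
    (hA' : ∀ j j' : J, j ≠ j' → infinitesimal V (A j) j' = 0) :
    AlgebraicIndependent K fun j : J =>
      Ideal.Quotient.mk (RingHom.ker (orbitMap V)) (MvPolynomial.X (j : Coord d)) := by
  classical
  have := Fintype.ofFinite J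
  rw [algebraicIndependent_iff]
  intro p hp
  have h1 : orbitMap V (MvPolynomial.rename (↑) p) = 0 := by
    have : Ideal.Quotient.mk (RingHom.ker (orbitMap V)) (MvPolynomial.rename (↑) p) = 0 := by
      rw [← hp, MvPolynomial.aeval_mk_X]
    exact Ideal.Quotient.eq_zero_iff_mem.1 this
  let R := MvPolynomial J K
  let S : Gl d R[X] := fun z =>
    ∑ j : J, (C (MvPolynomial.X j) : R[X]) • (A j z).map (algebraMap K R[X])
  -- The sign at the sources is negative because `twist` does not invert there: 1 - tS replaces the
  -- inverse of 1 + tS.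
  let h : Gl d R[X]
    | .y i => 1 - (X : R[X]) • S (.y i)
    | .x i => 1 + (X : R[X]) • S (.x i)
  let W : Rep d R[X] := fun a => (V a).map (algebraMap K R[X])
  have htwist : ∀ a, twist V h a = W a + ((X : R[X]) • (W a * S a.head - S a.tail * W a) -
      (X : R[X]) • (X : R[X]) • (S a.tail * W a * S a.head)) := by
    have : ∀ a, twist V h a =
        (1 - (X : R[X]) • S a.tail) * W a * (1 + (X : R[X]) • S a.head) := by
      rintro (i | i) <;> rfl
    intro a
    rw [this]
    simp only [Matrix.sub_mul, Matrix.mul_add, Matrix.one_mul, Matrix.mul_one, Matrix.smul_mul,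
      Matrix.mul_smul, smul_sub]
    abel
  have hlin : ∀ c : Coord d, coords (fun a => W a * S a.head - S a.tail * W a) c =
      ∑ j : J, C (MvPolynomial.X j) * algebraMap K R[X] (infinitesimal V (A j) c) := by
    intro c
    simp only [coords, S]
    rw [Matrix.mul_sum, Matrix.sum_mul]
    simp only [Matrix.mul_smul, Matrix.smul_mul]
    rw [Matrix.sub_apply, Matrix.sum_apply, Matrix.sum_apply, ← Finset.sum_sub_distrib]
    refine Finset.sum_congr rfl fun j _ => ?_
    rw [Matrix.smul_apply, Matrix.smul_apply, smul_eq_mul, smul_eq_mul, ← mul_sub]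
    congr 1
    simp only [W, ← Matrix.map_mul]
    simp only [Matrix.map_apply, ← map_sub]
    rfl
  have h2 := aeval_orbitMap V h (MvPolynomial.rename (↑) p)
  rw [h1, map_zero, MvPolynomial.aeval_rename] at h2
  refine Polynomial.eq_zero_of_aeval_eq_zero (fun j : J => coords V j)
    (fun j : J => - coords (fun a => S a.tail * W a * S a.head) j) p ?_
  rw [h2]
  congr 2
  funext j
  have h3 : coords (fun a => W a * S a.head - S a.tail * W a) j = C (MvPolynomial.X j) := by
    rw [hlin, Finset.sum_eq_single j]
    · rw [hA, map_one, mul_one]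
    · intro j' _ hne
      rw [hA' _ _ hne, map_zero, mul_zero]
    · simp
  have h4 := congrFun (congrFun (htwist j.1.1) j.1.2.1) j.1.2.2
  simp only [Function.comp_apply]
  rw [show coords (twist V h) j = _ from h4, ← h3]
  simp only [Matrix.add_apply, Matrix.sub_apply, Matrix.smul_apply, smul_eq_mul, coords, W,
    Matrix.map_apply]
  ring

end BipartiteA

/-! ### Endomorphisms of a representation and a slice transverse to them -/

namespace BipartiteA

variable {n : ℕ} {d : Vertex n → ℕ}

/-- The image of a tuple of matrices under a map of the entries. -/
def Gl.map {A B : Type*} (f : A → B) (x : Gl d A) : Gl d B :=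
  fun z => (x z).map f

theorem Gl.map_mul {A B : Type*} [CommRing A] [CommRing B] (f : A →+* B) (x y : Gl d A) :
    Gl.map f (x * y) = Gl.map f x * Gl.map f y := by
  funext z
  exact Matrix.map_mul

/-- The element with a single nonzero entry `1`. -/
def Gl.single {K : Type*} [CommRing K] (g : GlIndex d) : Gl d K :=
  Pi.single g.1 (Matrix.single g.2.1 g.2.2 1)

theorem Gl.single_apply {K : Type*} [CommRing K] [DecidableEq (GlIndex d)] (g g' : GlIndex d) :
    (Gl.single g : Gl d K) g'.1 g'.2.1 g'.2.2 = if g = g' then 1 else 0 := by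
  obtain ⟨z, i, j⟩ := g
  obtain ⟨z', i', j'⟩ := g'
  by_cases hz : z = z'
  · subst hz
    simp only [Gl.single, Pi.single_eq_same, Matrix.single_apply]
    congr 1
    simp
  · rw [if_neg (by simp [hz])]
    simp [Gl.single, Pi.single_eq_of_ne (Ne.symm hz)]

theorem Gl.sum_single {K : Type*} [CommRing K] (x : Gl d K) :
    x = ∑ g : GlIndex d, x g.1 g.2.1 g.2.2 • Gl.single g := by
  classical
  funext z
  ext i j
  rw [Finset.sum_apply, Matrix.sum_apply, Finset.sum_eq_single ⟨z, i, j⟩]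
  · have := Gl.single_apply (K := K) (⟨z, i, j⟩ : GlIndex d) ⟨z, i, j⟩
    simp only [if_true] at this
    simp [this]
  · intro g _ hg
    have := Gl.single_apply (K := K) g (⟨z, i, j⟩ : GlIndex d)
    rw [if_neg hg] at this
    simp [this]
  · simp

/-- The extension of scalars of a linear functional on `Gl d K`. -/
def extendFunctional {K : Type*} (A : Type*) [Field K] [CommRing A] [Algebra K A]
    (φ : Gl d K →ₗ[K] K) : Gl d A →ₗ[A] A where
  toFun x := ∑ g : GlIndex d, algebraMap K A (φ (Gl.single g)) * x g.1 g.2.1 g.2.2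
  map_add' x y := by
    rw [← Finset.sum_add_distrib]
    exact Finset.sum_congr rfl fun g _ => mul_add _ _ _
  map_smul' a x := by
    rw [RingHom.id_apply, smul_eq_mul, Finset.mul_sum]
    exact Finset.sum_congr rfl fun g _ => mul_left_comm _ _ _

section extendFunctional

variable {K A B : Type*} [Field K] [CommRing A] [Algebra K A] [CommRing B] [Algebra K B]

theorem extendFunctional_apply (φ : Gl d K →ₗ[K] K) (x : Gl d A) :
    extendFunctional A φ x =
      ∑ g : GlIndex d, algebraMap K A (φ (Gl.single g)) * x g.1 g.2.1 g.2.2 := rfl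

theorem extendFunctional_self (φ : Gl d K →ₗ[K] K) (x : Gl d K) :
    extendFunctional K φ x = φ x := by
  conv_rhs => rw [Gl.sum_single x, map_sum]
  rw [extendFunctional_apply]
  refine Finset.sum_congr rfl fun g _ => ?_
  rw [map_smul, smul_eq_mul, mul_comm]
  rfl

theorem map_extendFunctional (f : A →ₐ[K] B) (φ : Gl d K →ₗ[K] K) (x : Gl d A) :
    f (extendFunctional A φ x) = extendFunctional B φ (Gl.map f x) := by
  rw [extendFunctional_apply, extendFunctional_apply, map_sum]
  refine Finset.sum_congr rfl fun g _ => ?_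
  rw [map_mul, f.commutes]
  rfl

/-- A basis over `K` remains one after extension of scalars, so control of all coordinates in `β`
gives control of all entries. -/
theorem sum_extendFunctional {ι : Type*} [Fintype ι] (β : Module.Basis ι K (Gl d K)) (x : Gl d A)
    (g : GlIndex d) :
    x g.1 g.2.1 g.2.2 =
      ∑ k, algebraMap K A (β k g.1 g.2.1 g.2.2) * extendFunctional A (β.coord k) x := by
  classical
  have h1 : ∀ g' : GlIndex d, ∑ k, algebraMap K A (β k g.1 g.2.1 g.2.2) *
      algebraMap K A (β.coord k (Gl.single g')) = if g' = g then 1 else 0 := by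
    intro g'
    have h := congrArg (fun y : Gl d K => y g.1 g.2.1 g.2.2) (β.sum_repr (Gl.single g'))
    simp only [Gl.single_apply, Finset.sum_apply, Matrix.sum_apply, Pi.smul_apply,
      Matrix.smul_apply, smul_eq_mul] at h
    have h2 := congrArg (algebraMap K A) h
    rw [map_sum] at h2
    simp only [map_mul] at h2
    rw [apply_ite (algebraMap K A), map_one, map_zero] at h2
    rw [← h2]
    exact Finset.sum_congr rfl fun k _ => mul_comm _ _
  simp only [extendFunctional_apply, Finset.mul_sum]
  rw [Finset.sum_comm]
  simp only [← mul_assoc]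
  simp only [← Finset.sum_mul, h1]
  simp

end extendFunctional

/-- The intertwining condition `s_{ta} V_a = V_a s_{ha}` over a `K`-algebra. -/
def Intertwines {K A : Type*} [Field K] [CommRing A] [Algebra K A] (V : Rep d K) (s : Gl d A) :
    Prop :=
  ∀ a, s a.tail * (V a).map (algebraMap K A) = (V a).map (algebraMap K A) * s a.head

theorem mem_ker_infinitesimal {K : Type*} [Field K] (V : Rep d K) (s : Gl d K) :
    s ∈ LinearMap.ker (infinitesimal V) ↔ ∀ a, s a.tail * V a = V a * s a.head := by
  rw [LinearMap.mem_ker]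
  constructor
  · intro h a
    ext i j
    have := congrFun h ⟨a, i, j⟩
    exact (sub_eq_zero.1 this).symm
  · intro h
    funext c
    have := congrFun (congrFun (h c.1) c.2.1) c.2.2
    exact sub_eq_zero.2 this.symm

/-- A basis of `Gl d K` which extends a basis of the endomorphism algebra of `V`. -/
theorem exists_basis_extending_ker {K : Type*} [Field K] (V : Rep d K) :
    ∃ (e r : ℕ) (β : Module.Basis (Fin e ⊕ Fin r) K (Gl d K)),
      r = Module.finrank K (LinearMap.range (infinitesimal V)) ∧
      (∀ k, β (.inl k) ∈ LinearMap.ker (infinitesimal V)) ∧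
      ∀ x ∈ LinearMap.ker (infinitesimal V), ∑ k, β.coord (.inl k) x • β (.inl k) = x := by
  obtain ⟨C, hC⟩ := Submodule.exists_isCompl (LinearMap.ker (infinitesimal V))
  let β := ((Module.finBasis K (LinearMap.ker (infinitesimal V))).prod
    (Module.finBasis K C)).map (Submodule.prodEquivOfIsCompl _ _ hC)
  refine ⟨_, _, β, ?_, ?_, ?_⟩
  · have h1 := LinearMap.finrank_range_add_finrank_ker (infinitesimal V)
    have h2 := Submodule.finrank_add_eq_of_isCompl hC
    omega
  · intro k
    simp [β]
  · intro x hx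
    have hrepr : ∀ k, β.coord (.inr k) x = 0 := by
      intro k
      have : (Submodule.prodEquivOfIsCompl _ _ hC).symm x = (⟨x, hx⟩, 0) :=
        (LinearEquiv.symm_apply_eq _).2 (by simp)
      simp [β, this]
    conv_rhs => rw [← β.sum_repr x]
    rw [Fintype.sum_sum_type]
    have : ∑ k, β.repr x (.inr k) • β (.inr k) = 0 :=
      Finset.sum_eq_zero fun k _ => by
        have := hrepr k
        rw [Module.Basis.coord_apply] at this
        rw [this, zero_smul]
    rw [this, add_zero]
    rfl

/-- A family of matrices that specializes to the identity can be moved by an endomorphism of `V`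
into an affine complement of the endomorphism algebra. -/
theorem exists_intertwiner {K R : Type*} [Field K] [CommRing R] [Algebra K R] (V : Rep d K)
    (ε : R →ₐ[K] K) (γ : Gl d R) (hγ : Gl.map ε γ = 1) {e r : ℕ}
    (β : Module.Basis (Fin e ⊕ Fin r) K (Gl d K))
    (hker : ∀ k, β (.inl k) ∈ LinearMap.ker (infinitesimal V))
    (hsum : ∑ k, β.coord (.inl k) 1 • β (.inl k) = 1) :
    ∃ (s : Gl d R) (δ : R), ε δ = 1 ∧ Intertwines V s ∧ Gl.map ε s = 1 ∧
      ∀ k, extendFunctional R (β.coord (.inl k)) (s * γ) =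
        δ * algebraMap K R (β.coord (.inl k) 1) := by
  let b : Fin e → Gl d R := fun l => Gl.map (algebraMap K R) (β (.inl l))
  have hb : ∀ l, Gl.map ε (b l) = β (.inl l) := by
    intro l
    funext z
    ext i j
    simp [b, Gl.map]
  -- Column l holds the endomorphism coordinates of the product of the l-th basis endomorphism with
  -- `γ`. It specializes to the identity, so its determinant specializes to 1.
  let N : Matrix (Fin e) (Fin e) R :=
    Matrix.of fun k l => extendFunctional R (β.coord (.inl k)) (b l * γ)
  have hN : ε.mapMatrix N = 1 := by
    ext k l
    rw [AlgHom.mapMatrix_apply, Matrix.map_apply]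
    simp only [N, Matrix.of_apply]
    have hmul : Gl.map ε (b l * γ) = β (.inl l) := by
      have := Gl.map_mul (ε : R →+* K) (b l) γ
      refine this.trans ?_
      change Gl.map ε (b l) * Gl.map ε γ = _
      rw [hb, hγ, mul_one]
    rw [map_extendFunctional, extendFunctional_self, hmul, Module.Basis.coord_apply,
      Module.Basis.repr_self, Matrix.one_apply, Finsupp.single_apply]
    simp [eq_comm]
  let u : Fin e → R := fun k => algebraMap K R (β.coord (.inl k) 1)
  -- Cramer's rule without division: N c = det(N) u, which explains δ = det N.
  let c : Fin e → R := N.adjugate.mulVec u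
  have hεc : ∀ k, ε (c k) = β.coord (.inl k) 1 := by
    intro k
    have h1 : ε (c k) = ((ε.mapMatrix N.adjugate).mulVec (ε ∘ u)) k := by
      simp only [c, Matrix.mulVec, dotProduct, map_sum, map_mul]
      rfl
    rw [h1, AlgHom.map_adjugate, hN, Matrix.adjugate_one, Matrix.one_mulVec]
    simp [u]
  refine ⟨∑ l, c l • b l, N.det, ?_, ?_, ?_, ?_⟩
  · rw [AlgHom.map_det, hN, Matrix.det_one]
  · intro a
    simp only [Finset.sum_apply, Pi.smul_apply]
    rw [Matrix.sum_mul, Matrix.mul_sum]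
    refine Finset.sum_congr rfl fun l _ => ?_
    rw [Matrix.smul_mul, Matrix.mul_smul]
    congr 1
    simp only [b, Gl.map]
    rw [← Matrix.map_mul, ← Matrix.map_mul, (mem_ker_infinitesimal V _).1 (hker l) a]
  · rw [← hsum]
    funext z
    ext i j
    simp only [Gl.map, Matrix.map_apply, Finset.sum_apply, Pi.smul_apply, Matrix.sum_apply,
      Matrix.smul_apply, smul_eq_mul, map_sum, map_mul, hεc]
    refine Finset.sum_congr rfl fun l _ => ?_
    congr 1
    exact congrFun (congrFun (congrFun (hb l) z) i) j
  · intro k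
    have h1 : N.mulVec c = N.det • u := by
      simp only [c]
      rw [Matrix.mulVec_mulVec, Matrix.mul_adjugate, Matrix.smul_mulVec, Matrix.one_mulVec]
    have h2 := congrFun h1 k
    simp only [Pi.smul_apply, smul_eq_mul, u] at h2
    rw [← h2, Finset.sum_mul, map_sum]
    simp only [Matrix.mulVec, dotProduct, N, Matrix.of_apply]
    refine Finset.sum_congr rfl fun l _ => ?_
    rw [smul_mul_assoc, map_smul, smul_eq_mul, mul_comm]

end BipartiteA

/-! ### The upper bound for the transcendence degree, and the codimension -/

namespace BipartiteA

variable {n : ℕ} {d : Vertex n → ℕ}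

/-- `genericDet` times the inverse of the generic matrix at a source, and `genericDet` times the
generic matrix at a sink. -/
noncomputable def scaledInverse (d : Vertex n → ℕ) (K : Type*) [CommRing K] :
    Gl d (MvPolynomial (GlIndex d) K)
  | .y i => (∏ z ∈ Finset.univ.erase (.y i), (generic d K z).det) • (generic d K (.y i)).adjugate
  | .x i => genericDet d K • generic d K (.x i)

/-- The group element that carries the generic orbit point back to `V` satisfies a homogeneous
linear relation. Scaling it by `genericDet` at all vertices preserves the relation and clears
denominators. -/
theorem scaledInverse_mul_twist {K : Type*} [Field K] (V : Rep d K) (a : Arrow n) :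
    scaledInverse d K a.tail * twist V (generic d K) a =
      (V a).map (algebraMap K (MvPolynomial (GlIndex d) K)) * scaledInverse d K a.head := by
  have h1 : ∀ i, scaledInverse d K (.y i) * generic d K (.y i) = genericDet d K • 1 := by
    intro i
    simp only [scaledInverse]
    rw [Matrix.smul_mul, Matrix.adjugate_mul, smul_smul, genericDet]
    congr 1
    exact Finset.prod_erase_mul _ _ (Finset.mem_univ _)
  have h2 : scaledInverse d K a.tail * generic d K a.tail = genericDet d K • 1 := by
    cases a <;> exact h1 _
  have h3 : scaledInverse d K a.head = genericDet d K • generic d K a.head := by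
    cases a <;> rfl
  simp only [twist]
  rw [← Matrix.mul_assoc, ← Matrix.mul_assoc, h2, h3, Matrix.smul_mul,
    Matrix.one_mul, Matrix.smul_mul, Matrix.mul_smul]

/-- Evaluation of the generic matrices at the identity. -/
noncomputable def evalOne (d : Vertex n → ℕ) (K : Type*) [Field K] :
    MvPolynomial (GlIndex d) K →ₐ[K] K :=
  MvPolynomial.aeval fun g : GlIndex d => (1 : Gl d K) g.1 g.2.1 g.2.2

theorem map_evalOne_generic {K : Type*} [Field K] (z : Vertex n) :
    (generic d K z).map (evalOne d K) = 1 :=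
  generic_map _ z

theorem evalOne_det_generic {K : Type*} [Field K] (z : Vertex n) :
    evalOne d K (generic d K z).det = 1 := by
  rw [AlgHom.map_det, AlgHom.mapMatrix_apply, map_evalOne_generic, Matrix.det_one]

theorem map_evalOne_scaledInverse {K : Type*} [Field K] :
    Gl.map (evalOne d K) (scaledInverse d K) = 1 := by
  have hsmul : ∀ {m : ℕ} (q : MvPolynomial (GlIndex d) K) (M : Matrix (Fin m) (Fin m) _),
      evalOne d K q = 1 → (q • M).map (evalOne d K) = M.map (evalOne d K) := by
    intro m q M hq
    ext i j
    simp [hq]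
  funext z
  cases z with
  | y i =>
    simp only [Gl.map, scaledInverse]
    rw [hsmul]
    · have := AlgHom.map_adjugate (evalOne d K) (generic d K (.y i))
      rw [AlgHom.mapMatrix_apply, AlgHom.mapMatrix_apply, map_evalOne_generic,
        Matrix.adjugate_one] at this
      exact this
    · rw [map_prod]
      exact Finset.prod_eq_one fun z _ => evalOne_det_generic z
  | x i =>
    simp only [Gl.map, scaledInverse]
    rw [hsmul]
    · exact map_evalOne_generic _
    · rw [genericDet, map_prod]
      exact Finset.prod_eq_one fun z _ => evalOne_det_generic z

/-- If `c_{ta} f_a = V_a c_{ha}` with invertible `c_z`, then the entries of `f_a` lie in every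
intermediate field that contains the entries of all `c_z`. -/
theorem coords_mem_of_intertwine {K E : Type*} [Field K] [Field E] [Algebra K E]
    (M : IntermediateField K E) (V : Rep d K) (c : Gl d E) (f : Rep d E)
    (hc : ∀ z i j, c z i j ∈ M) (hdet : ∀ z, (c z).det ≠ 0)
    (hf : ∀ a, c a.tail * f a = (V a).map (algebraMap K E) * c a.head) (x : Coord d) :
    coords f x ∈ M := by
  let c' : Gl d M := fun z => Matrix.of fun i j => ⟨c z i j, hc z i j⟩
  have hc' : ∀ z, (c' z).map M.val = c z := fun z => rfl
  have hdet' : ∀ z, IsUnit (c' z).det := by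
    intro z
    rw [isUnit_iff_ne_zero]
    intro h
    apply hdet z
    rw [← hc', ← AlgHom.mapMatrix_apply, ← AlgHom.map_det, h, map_zero]
  obtain ⟨a, i, j⟩ := x
  let F := (c' a.tail)⁻¹ * ((V a).map (algebraMap K M) * c' a.head)
  have hF : F.map M.val = f a := by
    have h1 : ((c' a.tail)⁻¹).map M.val * c a.tail = 1 := by
      rw [← hc', ← Matrix.map_mul, Matrix.nonsing_inv_mul _ (hdet' _)]
      simp
    have h2 : F.map M.val = ((c' a.tail)⁻¹).map M.val * (c a.tail * f a) := by
      simp only [F]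
      rw [Matrix.map_mul, Matrix.map_mul, hf, hc', Matrix.map_map]
      rfl
    rw [h2, ← Matrix.mul_assoc, h1, Matrix.one_mul]
  have : coords f ⟨a, i, j⟩ = (F i j : E) := by
    simp only [coords]
    rw [← hF]
    rfl
  rw [this]
  exact (F i j).2

/-- Let f be the generic orbit point. An invertible c with c_{ta} f_a = V_a c_{ha} determines f
rationally, and c may be multiplied on the left by endomorphisms of `V`. This freedom fixes the
coordinates of c along End(V) to be constants, so f is defined over the field generated by the
remaining r coordinates, where r is the rank of the differential. -/
theorem trdeg_quotient_le {K : Type*} [Field K] (V : Rep d K) :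
    Algebra.trdeg K (MvPolynomial (Coord d) K ⧸ RingHom.ker (orbitMap V)) ≤
      (Module.finrank K (LinearMap.range (infinitesimal V)) : Cardinal) := by
  let R := MvPolynomial (GlIndex d) K
  let E := FractionRing R
  obtain ⟨e, r, β, hr, hker, hsum⟩ := exists_basis_extending_ker V
  have hone : (1 : Gl d K) ∈ LinearMap.ker (infinitesimal V) := by
    rw [mem_ker_infinitesimal]
    intro a
    simp
  obtain ⟨s, δ, hδ, hs, hs1, hext⟩ := exists_intertwiner V (evalOne d K) (scaledInverse d K)
    map_evalOne_scaledInverse β hker (hsum 1 hone)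
  let ι : R →ₐ[K] E := IsScalarTower.toAlgHom K R E
  have hι : Function.Injective ι := IsFractionRing.injective R E
  let θ : E := (ι δ)⁻¹
  have hδ0 : ι δ ≠ 0 := by
    rw [Ne, map_eq_zero_iff ι hι]
    rintro rfl
    simp at hδ
  -- Division by δ makes the endomorphism coordinates equal to those of the identity, hence elements
  -- of `K`.
  let c : Gl d E := θ • Gl.map ι (s * scaledInverse d K)
  let t : Fin r → E := fun k => extendFunctional E (β.coord (.inr k)) c
  let M := IntermediateField.adjoin K (Set.range t)
  have hmemM : ∀ k, extendFunctional E (β.coord k) c ∈ M := by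
    rintro (k | k)
    · have : extendFunctional E (β.coord (.inl k)) c =
          algebraMap K E (β.coord (.inl k) 1) := by
        simp only [c]
        rw [map_smul, ← map_extendFunctional, hext, map_mul, ι.commutes, smul_eq_mul, ← mul_assoc,
          inv_mul_cancel₀ hδ0, one_mul]
      rw [this]
      exact M.algebraMap_mem _
    · exact IntermediateField.subset_adjoin _ _ ⟨k, rfl⟩
  have hcM : ∀ z i j, c z i j ∈ M := by
    intro z i j
    rw [sum_extendFunctional β c ⟨z, i, j⟩]
    exact sum_mem fun k _ => mul_mem (M.algebraMap_mem _) (hmemM k)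
  -- A determinant that specializes to 1 at the identity is nonzero.
  have hdetR : ∀ x : Gl d R, Gl.map (evalOne d K) x = 1 → ∀ z, (x z).det ≠ 0 := by
    intro x hx z h
    have h1 : evalOne d K (x z).det = 1 := by
      rw [AlgHom.map_det, AlgHom.mapMatrix_apply]
      rw [show (x z).map (evalOne d K) = 1 from congrFun hx z, Matrix.det_one]
    rw [h, map_zero] at h1
    exact zero_ne_one h1
  have hdet : ∀ z, (c z).det ≠ 0 := by
    intro z
    have h1 : c z = θ • ι.mapMatrix (s z * scaledInverse d K z) := rfl
    rw [h1, Matrix.det_smul, ← AlgHom.map_det, Matrix.det_mul]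
    refine mul_ne_zero (pow_ne_zero _ (inv_ne_zero hδ0)) ?_
    rw [Ne, map_eq_zero_iff ι hι]
    exact mul_ne_zero (hdetR s hs1 z) (hdetR _ map_evalOne_scaledInverse z)
  let f : Rep d E := fun a => (twist V (generic d K) a).map ι
  have hf : ∀ a, c a.tail * f a = (V a).map (algebraMap K E) * c a.head := by
    intro a
    have h1 : s a.tail * scaledInverse d K a.tail * twist V (generic d K) a =
        (V a).map (algebraMap K R) * (s a.head * scaledInverse d K a.head) := by
      rw [Matrix.mul_assoc, scaledInverse_mul_twist, ← Matrix.mul_assoc, hs a, Matrix.mul_assoc]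
    have h2 : ∀ z, c z = θ • (s z * scaledInverse d K z).map ι := fun z => rfl
    have h3 : ((V a).map (algebraMap K R)).map ι = (V a).map (algebraMap K E) := by
      ext i j
      exact ι.commutes _
    rw [h2, h2, Matrix.smul_mul, Matrix.mul_smul, ← h3, ← Matrix.map_mul, ← Matrix.map_mul, h1]
  have hcoord := coords_mem_of_intertwine M V c f hcM hdet hf
  let g : (MvPolynomial (Coord d) K ⧸ RingHom.ker (orbitMap V)) →ₐ[K] E :=
    ι.comp (Ideal.kerLiftAlg (orbitMap V))
  have hg : Function.Injective g := hι.comp (Ideal.kerLiftAlg_injective (orbitMap V))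
  have hgM : ∀ b, g b ∈ M := by
    intro b
    obtain ⟨p, rfl⟩ := Ideal.Quotient.mk_surjective b
    change ι (orbitMap V p) ∈ M
    induction p using MvPolynomial.induction_on with
    | C a =>
      rw [show (MvPolynomial.C a : MvPolynomial (Coord d) K) = algebraMap K _ a from rfl,
        (orbitMap V).commutes, ι.commutes]
      exact M.algebraMap_mem _
    | add p q hp hq => rw [map_add, map_add]; exact add_mem hp hq
    | mul_X p j hp =>
      rw [map_mul, map_mul]
      refine mul_mem hp ?_
      rw [orbitMap, MvPolynomial.aeval_X]
      exact hcoord j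
  have := Algebra.trdeg_le_of_range_le_adjoin t g hg hgM
  rw [Nat.card_fin] at this
  rwa [← hr]

instance {K : Type*} [Field K] (V : Rep d K) : (RingHom.ker (orbitMap V)).IsPrime :=
  RingHom.ker_isPrime _

/-- The codimension of a quiver locus is the corank of the differential of the orbit map. -/
theorem codim_quiverLocus_eq_corank {K L : Type*} [Field K] [Field L] [Algebra K L] [Infinite L]
    (V : Rep d K) : codim K (quiverLocus L V) =
      ((Fintype.card (Coord d) - Module.finrank K (LinearMap.range (infinitesimal V)) : ℕ) : ℕ∞) := by
  obtain ⟨J, hJ, A, hA, hA'⟩ := (infinitesimal V).exists_coords_dual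
  have hind := algebraicIndependent_coords V J A hA hA'
  have hbasis : IsTranscendenceBasis K fun j : J =>
      Ideal.Quotient.mk (RingHom.ker (orbitMap V)) (MvPolynomial.X (j : Coord d)) := by
    -- An independent family with at least as many members as the transcendence degree is a basis.
    refine hind.isTranscendenceBasis_of_lift_trdeg_le_of_finite ?_
    have h := Cardinal.lift_le.{0}.2 (trdeg_quotient_le V)
    rw [← hJ] at h
    have := Fintype.ofFinite J
    simpa using h
  rw [codim_quiverLocus, MvPolynomial.height_of_isTranscendenceBasis _ J hbasis, ← hJ,
    ← Nat.card_eq_fintype_card]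
  congr 1
  have := Set.ncard_add_ncard_compl J
  rw [Nat.card_coe_set_eq, Nat.card_coe_set_eq]
  omega

end BipartiteA

/-! ### Lengths of completions and Rothe diagrams -/

namespace BipartiteA

/-- The Rothe diagram of a partial permutation. -/
def rothe {k l : ℕ} (w : Fin k ≃. Fin l) : Set (Fin k × Fin l) :=
  {p | (∀ j ∈ w p.1, p.2 < j) ∧ ∀ i ∈ w.symm p.2, p.1 < i}

/-- The inversion (i, i') corresponds to the cell (i, v i') of the Rothe diagram of `v`. -/
theorem length_eq_ncard {m : ℕ} (v : Equiv.Perm (Fin m)) :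
    length v = {p : Fin m × Fin m | p.2 < v p.1 ∧ p.1 < v⁻¹ p.2}.ncard := by
  have h1 : length v = {p : Fin m × Fin m | p.1 < p.2 ∧ v p.2 < v p.1}.ncard := by
    rw [length, ← Set.ncard_coe_finset]
    simp
  rw [h1]
  refine Set.ncard_congr (fun p _ => (p.1, v p.2)) ?_ ?_ ?_
  · rintro ⟨i, i'⟩ ⟨h, h'⟩
    exact ⟨h', by simpa using h⟩
  · rintro ⟨i, i'⟩ ⟨a, a'⟩ - - h
    simpa using h
  · rintro ⟨i, j⟩ ⟨h, h'⟩
    exact ⟨(i, v⁻¹ j), ⟨h', by simpa using h⟩, by simp⟩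

theorem length_inv {m : ℕ} (v : Equiv.Perm (Fin m)) : length v⁻¹ = length v := by
  rw [length_eq_ncard, length_eq_ncard]
  refine Set.ncard_congr (fun p _ => p.swap) ?_ ?_ ?_
  · rintro ⟨i, j⟩ ⟨h, h'⟩
    exact ⟨by simpa using h', h⟩
  · rintro p q - - h
    exact Prod.swap_injective h
  · rintro ⟨i, j⟩ ⟨h, h'⟩
    exact ⟨(j, i), ⟨h', by simpa using h⟩, rfl⟩

theorem length_rotPerm {m : ℕ} (v : Equiv.Perm (Fin m)) : length (rotPerm v) = length v := by
  refine Finset.card_bij (fun p _ => (Fin.rev p.2, Fin.rev p.1)) ?_ ?_ ?_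
  · rintro ⟨i, j⟩ h
    simpa [rotPerm] using h
  · rintro ⟨i, j⟩ _ ⟨a, b⟩ _ h
    simp only [Prod.mk.injEq, Fin.rev_inj] at h
    rw [h.1, h.2]
  · rintro ⟨i, j⟩ h
    exact ⟨(Fin.rev j, Fin.rev i), by simpa [rotPerm] using h, by simp⟩

/-- Removing an adjacent descent shortens a permutation. -/
theorem length_mul_swap_lt {m : ℕ} (v : Equiv.Perm (Fin m)) {i j : Fin m}
    (hij : (j : ℕ) = i + 1) (h : v j < v i) : length (v * Equiv.swap i j) < length v := by
  have hmem : ((i, j) : Fin m × Fin m) ∈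
      Finset.univ.filter fun p : Fin m × Fin m => p.1 < p.2 ∧ v p.2 < v p.1 := by
    simp only [Finset.mem_filter, Finset.mem_univ, true_and]
    exact ⟨by rw [Fin.lt_def]; omega, h⟩
  -- An adjacent transposition preserves the order of every increasing pair except (i, j), so
  -- inversions of the product inject into the inversions of `v` other than (i, j).
  have hswap : ∀ a b : Fin m, a < b → ¬(a = i ∧ b = j) → Equiv.swap i j a < Equiv.swap i j b := by
    intro a b hab hne
    simp only [Equiv.swap_apply_def, Fin.lt_def, Fin.ext_iff] at *
    split_ifs <;> omega
  refine lt_of_le_of_lt ?_ (Finset.card_erase_lt_of_mem hmem)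
  refine Finset.card_le_card_of_injOn (fun p => (Equiv.swap i j p.1, Equiv.swap i j p.2)) ?_ ?_
  · rintro ⟨a, b⟩ hab
    obtain ⟨hab, hv⟩ := (Finset.mem_filter.1 (Finset.mem_coe.1 hab)).2
    simp only [Equiv.Perm.mul_apply] at hab hv
    have hne : ¬(a = i ∧ b = j) := by
      rintro ⟨rfl, rfl⟩
      rw [Equiv.swap_apply_left, Equiv.swap_apply_right] at hv
      exact absurd hv h.asymm
    refine Finset.mem_coe.2 (Finset.mem_erase.2
      ⟨?_, Finset.mem_filter.2 ⟨Finset.mem_univ _, hswap a b hab hne, hv⟩⟩)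
    rw [Ne, Prod.mk.injEq]
    rintro ⟨h1, h2⟩
    rw [Equiv.swap_apply_eq_iff, Equiv.swap_apply_left] at h1
    rw [Equiv.swap_apply_eq_iff, Equiv.swap_apply_right] at h2
    simp only at h1 h2
    rw [h1, h2, Fin.lt_def] at hab
    omega
  · rintro ⟨a, b⟩ - ⟨a', b'⟩ - h
    simpa using h

theorem strictMono_of_adjacent {m k : ℕ} (v : Equiv.Perm (Fin m))
    (h : ∀ i j : Fin m, k ≤ i → (j : ℕ) = i + 1 → v i < v j) {i j : Fin m} (hi : k ≤ i)
    (hij : i < j) : v i < v j := by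
  obtain ⟨j, hj⟩ := j
  induction j with
  | zero => simp [Fin.lt_def] at hij
  | succ j ih =>
    have hj' : j < m := by omega
    have h1 : v ⟨j, hj'⟩ < v ⟨j + 1, hj⟩ := by
      apply h
      · rw [Fin.lt_def] at hij
        simp only at hij ⊢
        omega
      · rfl
    rcases (Nat.lt_succ_iff.1 (Fin.lt_def.1 hij)).eq_or_lt with heq | hlt
    · have : i = ⟨j, hj'⟩ := Fin.ext heq
      rwa [this]
    · exact (ih hj' hlt).trans h1

/-- Exchanging adjacent rows below the corner, or adjacent columns to its right, keeps the corner.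
Minimal length therefore makes `v` increasing on those rows and its inverse increasing on those
columns, so the Rothe diagram of `v` has no cells outside the corner. -/
theorem length_of_isCompletion {k l : ℕ} {w : Fin k ≃. Fin l} {v : Σ m : ℕ, Equiv.Perm (Fin m)}
    (hv : IsCompletion w v) : length v.2 = (rothe w).ncard := by
  obtain ⟨m, v⟩ := v
  obtain ⟨⟨hk, hl, hw⟩, -, hmin⟩ := hv
  simp only at *
  have hrow : ∀ i j : Fin m, k ≤ i → (j : ℕ) = i + 1 → v i < v j := by
    intro i j hi hij
    by_contra hlt
    have hne : v i ≠ v j := fun h => by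
      have := v.injective h
      rw [Fin.ext_iff] at this
      omega
    have hlt' : v j < v i := lt_of_le_of_ne (not_lt.1 hlt) hne.symm
    refine absurd (length_mul_swap_lt v hij hlt') (not_lt.2 (hmin _ ⟨hk, hl, fun a b => ?_⟩))
    rw [← hw a b, Equiv.Perm.mul_apply, Equiv.swap_apply_of_ne_of_ne]
    · rw [Ne, Fin.ext_iff]
      have := a.2
      simp only [Fin.val_castLE]
      omega
    · rw [Ne, Fin.ext_iff]
      have := a.2
      simp only [Fin.val_castLE]
      omega
  have hcol : ∀ i j : Fin m, l ≤ i → (j : ℕ) = i + 1 → v⁻¹ i < v⁻¹ j := by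
    intro i j hi hij
    by_contra hlt
    have hne : v⁻¹ i ≠ v⁻¹ j := fun h => by
      have := v⁻¹.injective h
      rw [Fin.ext_iff] at this
      omega
    have hlt' : v⁻¹ j < v⁻¹ i := lt_of_le_of_ne (not_lt.1 hlt) hne.symm
    have h1 := length_mul_swap_lt v⁻¹ hij hlt'
    rw [← length_inv (v⁻¹ * _), length_inv v, mul_inv_rev, inv_inv, Equiv.swap_inv] at h1
    refine absurd h1 (not_lt.2 (hmin _ ⟨hk, hl, fun a b => ?_⟩))
    rw [← hw a b, Equiv.Perm.mul_apply, Equiv.swap_apply_eq_iff, Equiv.swap_apply_of_ne_of_ne]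
    · rw [Ne, Fin.ext_iff]
      have := b.2
      simp only [Fin.val_castLE]
      omega
    · rw [Ne, Fin.ext_iff]
      have := b.2
      simp only [Fin.val_castLE]
      omega
  rw [length_eq_ncard]
  symm
  -- Inside the corner the two diagrams agree: a value of `v` to the left of or at `b` lies in the
  -- corner and comes from `w`, and likewise for the inverse.
  have hdiag : ∀ (a : Fin k) (b : Fin l), (a, b) ∈ rothe w ↔
      Fin.castLE hl b < v (Fin.castLE hk a) ∧ Fin.castLE hk a < v⁻¹ (Fin.castLE hl b) := by
    intro a b
    refine and_congr ?_ ?_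
    · constructor
      · intro h
        by_contra hlt
        have hlt' := not_lt.1 hlt
        have hvl : (v (Fin.castLE hk a) : ℕ) < l := lt_of_le_of_lt (Fin.le_def.1 hlt') b.2
        have h1 := (hw a ⟨_, hvl⟩).1 (Fin.ext rfl)
        have h2 := h _ h1
        exact absurd (Fin.lt_def.1 h2) (not_lt.2 (Fin.le_def.1 hlt'))
      · intro h j hj
        rw [(hw a j).2 hj] at h
        exact h
    · constructor
      · intro h
        by_contra hlt
        have hlt' := not_lt.1 hlt
        have hvl : (v⁻¹ (Fin.castLE hl b) : ℕ) < k := lt_of_le_of_lt (Fin.le_def.1 hlt') a.2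
        have h1 : b ∈ w ⟨_, hvl⟩ := (hw ⟨_, hvl⟩ b).1 (by
          rw [show Fin.castLE hk ⟨_, hvl⟩ = v⁻¹ (Fin.castLE hl b) from Fin.ext rfl]
          simp)
        have h2 := h _ (w.mem_iff_mem.2 h1)
        exact absurd (Fin.lt_def.1 h2) (not_lt.2 (Fin.le_def.1 hlt'))
      · intro h i hi
        have h1 := (hw i b).2 (w.mem_iff_mem.1 hi)
        rw [← h1] at h
        simpa using h
  refine Set.ncard_congr (fun p _ => (Fin.castLE hk p.1, Fin.castLE hl p.2)) ?_ ?_ ?_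
  · rintro ⟨a, b⟩ h
    exact (hdiag a b).1 h
  · rintro ⟨a, b⟩ ⟨a', b'⟩ - - h
    simpa using h
  · rintro ⟨i, j⟩ ⟨h, h'⟩
    simp only at h h'
    have hi : (i : ℕ) < k := by
      by_contra hik
      have := strictMono_of_adjacent v hrow (not_lt.1 hik) h'
      rw [← Equiv.Perm.mul_apply, mul_inv_cancel, Equiv.Perm.one_apply] at this
      exact absurd h this.asymm
    have hj : (j : ℕ) < l := by
      by_contra hjl
      have := strictMono_of_adjacent v⁻¹ hcol (not_lt.1 hjl) h
      rw [← Equiv.Perm.mul_apply, inv_mul_cancel, Equiv.Perm.one_apply] at this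
      exact absurd h' this.asymm
    exact ⟨(⟨i, hi⟩, ⟨j, hj⟩), (hdiag _ _).2 ⟨h, h'⟩, rfl⟩

theorem length_completion {k l : ℕ} (w : Fin k ≃. Fin l) :
    length (completion w).2 = (rothe w).ncard :=
  length_of_isCompletion (Classical.choose_spec (exists_isCompletion w))

end BipartiteA

namespace BipartiteA

/-! ### Maps given by chains

The differential of the orbit map of a lacing diagram is described by a graph that is a disjoint
union of chains, in which elements of `C` (the coordinates of the target) and of `G` (the
coordinates of the source) alternate: `lo c` and `hi c` are the neighbours of `c`. -/

section Chain

variable {C G K : Type*} [Field K]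

/-- The value of a function at an optional point, zero if there is none. -/
def valueAt (A : G → K) (o : Option G) : K := o.elim 0 A

/-- A family of chains, graded by `pos`. -/
structure ChainData (C G : Type*) where
  /-- the lower neighbour -/
  lo : C → Option G
  /-- the upper neighbour -/
  hi : C → Option G
  /-- the height -/
  pos : C → ℕ
  lo_inj : ∀ {c c' g}, lo c = some g → lo c' = some g → c = c'
  hi_inj : ∀ {c c' g}, hi c = some g → hi c' = some g → c = c'
  pos_lt : ∀ {c c' g}, lo c = some g → hi c' = some g → pos c' < pos c

namespace ChainData

variable (S : ChainData C G)

/-- The chains turned upside down. -/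
def flip [Fintype C] : ChainData C G where
  lo := S.hi
  hi := S.lo
  pos c := Finset.univ.sup S.pos - S.pos c
  lo_inj := S.hi_inj
  hi_inj := S.lo_inj
  pos_lt := by
    intro c c' g h h'
    have h1 := S.pos_lt h' h
    have h2 := Finset.le_sup (f := S.pos) (Finset.mem_univ c')
    omega

/-- Weights `ψ` on the chains which are constant along every chain and vanish on those chains that
end in `G`. -/
structure IsBalanced (ψ : C → K) : Prop where
  eq_of_link : ∀ {c c' g}, S.hi c = some g → S.lo c' = some g → ψ c = ψ c'
  hi_end : ∀ {c g}, S.hi c = some g → (∀ c', S.lo c' ≠ some g) → ψ c = 0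
  lo_end : ∀ {c g}, S.lo c = some g → (∀ c', S.hi c' ≠ some g) → ψ c = 0

variable {S} in
theorem IsBalanced.flip [Fintype C] {ψ : C → K} (h : S.IsBalanced ψ) : S.flip.IsBalanced ψ where
  eq_of_link h1 h2 := (h.eq_of_link h2 h1).symm
  hi_end := h.lo_end
  lo_end := h.hi_end

/-- The crossings with respect to an order with `<`-pairs `P` and `>`-pairs `N`. -/
def IsCrossing (P N : G → Prop) (c : C) : Prop :=
  (∀ g ∈ S.hi c, P g) ∧ ∀ g ∈ S.lo c, N g

/-- The pairs which are in neither of the relations `P`, `N` form full chains. -/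
def NeutralCompatible (P N : G → Prop) : Prop :=
  (∀ {c g}, S.lo c = some g → ¬P g → ¬N g → ∃ g' ∈ S.hi c, ¬P g' ∧ ¬N g') ∧
  ∀ {c g}, S.hi c = some g → ¬P g → ¬N g → ∃ g' ∈ S.lo c, ¬P g' ∧ ¬N g'

variable {S}

/-- Walk down the chain while the pairs are not in `N`; the weight is constant. The walk stops at a
pair in `N` or at a lower end in `C`, in both cases at a crossing, since a neutral upper neighbour
would force a neutral lower one. If the chain ends in `G` instead, the weight is zero by balance. -/
theorem IsBalanced.eq_zero_of_not_neg {P N : G → Prop} {ψ : C → K} (h : S.IsBalanced ψ)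
    (hZ : S.NeutralCompatible P N)
    (hψ : ∀ c, S.IsCrossing P N c → ψ c = 0) (c : C) (hc : ∀ g ∈ S.hi c, ¬N g) : ψ c = 0 := by
  induction hk : S.pos c using Nat.strong_induction_on generalizing c with
  | _ k ih =>
    rcases hlo : S.lo c with _ | g
    · refine hψ c ⟨fun g hg => ?_, by simp [hlo]⟩
      by_contra hP
      obtain ⟨g', hg', -⟩ := hZ.2 hg hP (hc g hg)
      simp [hlo] at hg'
    · by_cases hN : N g
      · refine hψ c ⟨fun g₁ hg₁ => ?_, fun g₁ hg₁ => ?_⟩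
        · by_contra hP
          obtain ⟨g', hg', h1, h2⟩ := hZ.2 hg₁ hP (hc g₁ hg₁)
          rw [hlo, Option.mem_some_iff] at hg'
          exact h2 (hg' ▸ hN)
        · rw [hlo, Option.mem_some_iff] at hg₁
          exact hg₁ ▸ hN
      · by_cases hex : ∃ c', S.hi c' = some g
        · obtain ⟨c', hc'⟩ := hex
          rw [← h.eq_of_link hc' hlo]
          refine ih _ (hk ▸ S.pos_lt hlo hc') c' (fun g₁ hg₁ => ?_) rfl
          rw [hc', Option.mem_some_iff] at hg₁
          exact hg₁ ▸ hN
        · exact h.lo_end hlo fun c' hc' => hex ⟨c', hc'⟩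

/-- Walk down if the upper neighbour is not in `N`, and up, with `P` and `N` exchanged, if the lower
neighbour is not in `P`. Otherwise the lower neighbour is in `P`, and the downward walk can start at
the next element of `C`. -/
theorem IsBalanced.eq_zero [Fintype C] {P N : G → Prop} {ψ : C → K} (h : S.IsBalanced ψ)
    (hPN : ∀ g, P g → ¬N g) (hZ : S.NeutralCompatible P N)
    (hψ : ∀ c, S.IsCrossing P N c → ψ c = 0) (c : C) : ψ c = 0 := by
  by_cases hc : ∀ g ∈ S.hi c, ¬N g
  · exact h.eq_zero_of_not_neg hZ hψ c hc
  by_cases hc' : ∀ g ∈ S.lo c, ¬P g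
  · refine h.flip.eq_zero_of_not_neg (P := N) (N := P) ?_ ?_ c hc'
    · refine ⟨fun h1 h2 h3 => ?_, fun h1 h2 h3 => ?_⟩
      · obtain ⟨g', hg', h4, h5⟩ := hZ.2 h1 h3 h2
        exact ⟨g', hg', h5, h4⟩
      · obtain ⟨g', hg', h4, h5⟩ := hZ.1 h1 h3 h2
        exact ⟨g', hg', h5, h4⟩
    · exact fun c h => hψ c ⟨h.2, h.1⟩
  · push Not at hc'
    obtain ⟨g, hg, hP⟩ := hc'
    by_cases hex : ∃ c', S.hi c' = some g
    · obtain ⟨c', hc'⟩ := hex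
      rw [← h.eq_of_link hc' hg]
      refine h.eq_zero_of_not_neg hZ hψ c' fun g₁ hg₁ => ?_
      rw [hc', Option.mem_some_iff] at hg₁
      exact hg₁ ▸ hPN g hP
    · exact h.lo_end hg fun c' hc' => hex ⟨c', hc'⟩

variable (S) in
/-- A linear map is given by the chains if each coordinate of its values is, up to sign, the
difference of the values at the two neighbours. -/
def Represents {M : Type*} [AddCommGroup M] [Module K M] (D : M →ₗ[K] (C → K)) (ev : M ≃ₗ[K] (G → K))
    : Prop :=
  ∃ s : C → K, (∀ c, s c ≠ 0) ∧
    ∀ x c, D x c = s c * (valueAt (ev x) (S.hi c) - valueAt (ev x) (S.lo c))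

/-- A functional that kills the range of `D` is, after rescaling by the signs, a balanced weight:
testing on the unit vector at g gives the relation between the two elements of `C` next to g. Such a
functional is determined by its values at the crossings, which bounds the corank. -/
theorem card_le_finrank_range_add [Fintype C] {M : Type*} [AddCommGroup M] [Module K M]
    {D : M →ₗ[K] (C → K)} {ev : M ≃ₗ[K] (G → K)} (hD : S.Represents D ev) {P N : G → Prop}
    (hPN : ∀ g, P g → ¬N g) (hZ : S.NeutralCompatible P N) :
    Fintype.card C ≤ Module.finrank K (LinearMap.range D) + {c | S.IsCrossing P N c}.ncard := by
  classical
  obtain ⟨s, hs, hD⟩ := hD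
  let Cr := {c | S.IsCrossing P N c}
  let res : (LinearMap.range D).dualAnnihilator →ₗ[K] (Cr → K) :=
    { toFun f c := f.1 (Pi.single (c : C) 1)
      map_add' _ _ := rfl
      map_smul' _ _ := rfl }
  have hker : ∀ f ∈ (LinearMap.range D).dualAnnihilator,
      (∀ c ∈ Cr, f (Pi.single c 1) = 0) → f = 0 := by
    intro f hf h0
    let φ : C → K := fun c => f (Pi.single c 1)
    have hfφ : ∀ v : C → K, f v = ∑ c, v c * φ c := by
      intro v
      conv_lhs => rw [pi_eq_sum_univ' v, map_sum]
      refine Finset.sum_congr rfl fun c _ => ?_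
      rw [map_smul, smul_eq_mul]
    have hrel : ∀ g, ∑ c, s c * ((if S.hi c = some g then 1 else 0) -
        (if S.lo c = some g then 1 else 0)) * φ c = 0 := by
      intro g
      have h1 : f (D (ev.symm (Pi.single g 1))) = 0 :=
        (Submodule.mem_dualAnnihilator f).1 hf _ ⟨_, rfl⟩
      rw [hfφ] at h1
      refine Eq.trans ?_ h1
      refine Finset.sum_congr rfl fun c _ => ?_
      rw [hD, LinearEquiv.apply_symm_apply]
      have hval : ∀ o : Option G, valueAt (Pi.single g (1 : K)) o = if o = some g then 1 else 0 := by
        rintro (_ | g')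
        · simp [valueAt]
        · simp [valueAt, Pi.single_apply]
      rw [hval, hval]
    have hrel' : ∀ g, ∑ c, (if S.hi c = some g then s c * φ c else 0) =
        ∑ c, if S.lo c = some g then s c * φ c else 0 := by
      intro g
      rw [← sub_eq_zero, ← Finset.sum_sub_distrib]
      refine Eq.trans ?_ (hrel g)
      refine Finset.sum_congr rfl fun c _ => ?_
      split_ifs <;> ring
    have hhi : ∀ {c g}, S.hi c = some g →
        ∑ c, (if S.hi c = some g then s c * φ c else 0) = s c * φ c := by
      intro c g hc
      rw [Finset.sum_eq_single c, if_pos hc]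
      · exact fun c' _ hne => if_neg fun h => hne (S.hi_inj h hc)
      · simp
    have hlo : ∀ {c g}, S.lo c = some g →
        ∑ c, (if S.lo c = some g then s c * φ c else 0) = s c * φ c := by
      intro c g hc
      rw [Finset.sum_eq_single c, if_pos hc]
      · exact fun c' _ hne => if_neg fun h => hne (S.lo_inj h hc)
      · simp
    have hbal : S.IsBalanced fun c => s c * φ c := by
      refine ⟨fun {c c' g} h1 h2 => ?_, fun {c g} h1 h2 => ?_, fun {c g} h1 h2 => ?_⟩
      · rw [← hhi h1, ← hlo h2, hrel']
      · rw [← hhi h1, hrel']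
        exact Finset.sum_eq_zero fun c' _ => if_neg (h2 c')
      · rw [← hlo h1, ← hrel']
        exact Finset.sum_eq_zero fun c' _ => if_neg (h2 c')
    have hzero : ∀ c, φ c = 0 := by
      intro c
      have := hbal.eq_zero hPN hZ (fun c hc => by
        rw [show φ c = 0 from h0 c hc, mul_zero]) c
      exact (mul_eq_zero.1 this).resolve_left (hs c)
    refine LinearMap.ext fun v => ?_
    rw [hfφ]
    simp [hzero]
  have hinj : Function.Injective res := by
    rintro ⟨f₁, h₁⟩ ⟨f₂, h₂⟩ h
    refine Subtype.ext (sub_eq_zero.1 (hker (f₁ - f₂) (sub_mem h₁ h₂) fun c hc => ?_))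
    exact sub_eq_zero.2 (congrFun h ⟨c, hc⟩)
  have h1 := LinearMap.finrank_le_finrank_of_injective hinj
  have h2 := Subspace.finrank_add_finrank_dualAnnihilator_eq (LinearMap.range D)
  rw [Module.finrank_fintype_fun_eq_card] at h1 h2
  have h3 : Fintype.card Cr = Cr.ncard := by
    rw [← Nat.card_eq_fintype_card, Nat.card_coe_set_eq]
  change _ ≤ _ + Cr.ncard
  omega

/-- The dual count: a vector of the range that vanishes off the crossings is zero. Under the
hypotheses a crossing can only be a lower end of a chain, and the upper end of that chain also lies
in `C`. Zero values then propagate down from the upper end. -/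
theorem finrank_range_add_le [Fintype C] {M : Type*} [AddCommGroup M] [Module K M]
    {D : M →ₗ[K] (C → K)} {ev : M ≃ₗ[K] (G → K)} (hD : S.Represents D ev) {P N Q : G → Prop}
    (hPN : ∀ g, P g → ¬N g)
    (hP : ∀ {c g g'}, S.lo c = some g → S.hi c = some g' → (P g ↔ P g'))
    (hQ : ∀ {c g g'}, S.lo c = some g → S.hi c = some g' → (Q g ↔ Q g'))
    (hhi : ∀ {c g}, S.hi c = none → S.lo c = some g → P g)
    (hlo : ∀ {c g}, S.lo c = none → S.hi c = some g → Q g)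
    (hup : ∀ {g}, P g → Q g → ∃ c, S.lo c = some g) :
    Module.finrank K (LinearMap.range D) + {c | S.IsCrossing P N c}.ncard ≤ Fintype.card C := by
  classical
  obtain ⟨s, hs, hD⟩ := hD
  let Cr := {c | S.IsCrossing P N c}
  let res : LinearMap.range D →ₗ[K] ((Crᶜ : Set C) → K) :=
    { toFun v c := v.1 c
      map_add' _ _ := rfl
      map_smul' _ _ := rfl }
  have hinj : Function.Injective res := by
    refine (injective_iff_map_eq_zero res).2 ?_
    rintro ⟨_, x, rfl⟩ h0
    have hoff : ∀ c, ¬S.IsCrossing P N c →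
        valueAt (ev x) (S.hi c) - valueAt (ev x) (S.lo c) = 0 := by
      intro c hc
      have h1 : D x c = 0 := congrFun h0 ⟨c, hc⟩
      rw [hD] at h1
      exact (mul_eq_zero.1 h1).resolve_left (hs c)
    -- An element of `C` whose lower neighbour is in `P` is not a crossing, so both neighbours have
    -- the same value; `P` and `Q` persist upwards until the upper neighbour is absent and the value
    -- is 0.
    have hzero : ∀ k c g, S.flip.pos c = k → S.lo c = some g → P g → Q g → ev x g = 0 := by
      intro k
      induction k using Nat.strong_induction_on with
      | _ k ih =>
        intro c g hk hc hPg hQg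
        have h1 := hoff c fun h => hPN g hPg (h.2 g hc)
        rcases hh : S.hi c with _ | g'
        · rw [hh, hc] at h1
          simpa [valueAt] using h1
        · have hP' := (hP hc hh).1 hPg
          have hQ' := (hQ hc hh).1 hQg
          obtain ⟨c', hc'⟩ := hup hP' hQ'
          have h2 := ih _ (hk ▸ S.flip.pos_lt hh hc') c' g' rfl hc' hP' hQ'
          rw [hh, hc] at h1
          simp only [valueAt, Option.elim] at h1
          rw [h2, zero_sub, neg_eq_zero] at h1
          exact h1
    have hval : ∀ g, P g → Q g → ev x g = 0 := by
      intro g hPg hQg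
      obtain ⟨c, hc⟩ := hup hPg hQg
      exact hzero _ c g rfl hc hPg hQg
    ext1
    funext c
    change D x c = 0
    rw [hD]
    by_cases hc : S.IsCrossing P N c
    · have hlo' : S.lo c = none := by
        by_contra hne
        obtain ⟨g, hg⟩ := Option.ne_none_iff_exists'.1 hne
        have hN := hc.2 g hg
        rcases hh : S.hi c with _ | g'
        · exact hPN g (hhi hh hg) hN
        · exact hPN g ((hP hg hh).2 (hc.1 g' hh)) hN
      rcases hh : S.hi c with _ | g
      · simp [hlo', valueAt]
      · simp [hlo', valueAt, hval g (hc.1 g hh) (hlo hlo' hh)]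
    · rw [hoff c hc, mul_zero]
  have h1 := LinearMap.finrank_le_finrank_of_injective hinj
  rw [Module.finrank_fintype_fun_eq_card, ← Nat.card_eq_fintype_card, Nat.card_coe_set_eq] at h1
  have h2 := Set.ncard_add_ncard_compl Cr
  rw [Nat.card_eq_fintype_card] at h2
  change _ + Cr.ncard ≤ _
  omega

end ChainData

end Chain

/-! ### Ends of paths in a graded graph -/

/-- In a graded functional graph, the end of the path starting at a point. -/
theorem exists_pathEnd {α : Type*} (r : α → α → Prop) (pos : α → ℕ) (m : ℕ)
    (hm : ∀ u, pos u ≤ m) (hpos : ∀ u v, r u v → pos v = pos u + 1)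
    (hfun : ∀ u v v', r u v → r u v' → v = v') (hinj : ∀ u u' v, r u v → r u' v → u = u') :
    ∃ e : α → α, (∀ u v, r u v → e u = e v) ∧ (∀ u, (∀ v, ¬r u v) → e u = u) ∧
      (∀ u, pos u ≤ pos (e u)) ∧ ∀ u v, e u = e v → pos u = pos v → u = v := by
  have hex : ∀ u, ∃ t, Relation.ReflTransGen r u t ∧ ∀ v, ¬r t v := by
    intro u
    induction hk : m - pos u generalizing u with
    | zero =>
      refine ⟨u, .refl, fun v hv => ?_⟩
      have := hpos u v hv
      have := hm v
      omega
    | succ k ih =>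
      by_cases h : ∃ v, r u v
      · obtain ⟨v, hv⟩ := h
        have := hpos u v hv
        obtain ⟨t, ht, ht'⟩ := ih v (by omega)
        exact ⟨t, .head hv ht, ht'⟩
      · exact ⟨u, .refl, fun v hv => h ⟨v, hv⟩⟩
  choose e he he' using hex
  have huniq' : ∀ u t, Relation.ReflTransGen r u t → (∀ v, ¬r t v) →
      ∀ t', Relation.ReflTransGen r u t' → (∀ v, ¬r t' v) → t' = t := by
    intro u t hut ht
    induction hut using Relation.ReflTransGen.head_induction_on with
    | refl =>
      intro t' h' _
      rcases Relation.ReflTransGen.cases_head h' with h | ⟨v, hv, -⟩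
      · exact h.symm
      · exact absurd hv (ht v)
    | head huv _ ih =>
      intro t' h' ht'
      rcases Relation.ReflTransGen.cases_head h' with h | ⟨v', hv', h⟩
      · exact absurd (h ▸ huv) (ht' _)
      · obtain rfl := hfun _ _ _ huv hv'
        exact ih t' h ht'
  have huniq : ∀ u t, Relation.ReflTransGen r u t → (∀ v, ¬r t v) → e u = t :=
    fun u t h ht => huniq' u t h ht _ (he u) (he' u)
  have hle : ∀ u t, Relation.ReflTransGen r u t → pos u ≤ pos t := by
    intro u t h
    induction h with
    | refl => exact le_rfl
    | tail _ h ih => rw [hpos _ _ h]; omega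
  refine ⟨e, fun u v huv => ?_, fun u hu => huniq u u .refl hu, fun u => hle _ _ (he u), ?_⟩
  · exact huniq u (e v) (.head huv (he v)) (he' v)
  · have key : ∀ u t, Relation.ReflTransGen r u t → ∀ v, Relation.ReflTransGen r v t →
        pos u = pos v → u = v := by
      intro u t hut
      induction hut using Relation.ReflTransGen.head_induction_on with
      | refl =>
        intro v hv hp
        rcases Relation.ReflTransGen.cases_head hv with h | ⟨v', hv', h⟩
        · exact h.symm
        · have := hpos _ _ hv'
          have := hle _ _ h
          omega
      | head huu' hu't ih =>
        intro v hv hp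
        have h1 := hpos _ _ huu'
        have h2 := hle _ _ hu't
        rcases Relation.ReflTransGen.cases_head hv with h | ⟨v', hv', h⟩
        · subst h
          omega
        · have h3 := hpos _ _ hv'
          obtain rfl := ih v' h (by omega)
          exact hinj _ _ _ huu' hv'
    intro u v huv hp
    exact key u (e u) (he u) v (huv ▸ he v) hp

end BipartiteA

/-! ### The chains of a lacing diagram and the inequality for every diagram -/

namespace BipartiteA

variable {n : ℕ} {d : Vertex n → ℕ}

namespace LacingDiagram

/-- The neighbour in the lower one of the two columns of a coordinate. -/
def chainLo (w : LacingDiagram d) : Coord d → Option (GlIndex d)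
  | ⟨.α i, k, l⟩ => ((w (.α i)).symm l).map fun k' => ⟨.y i.castSucc, k, k'⟩
  | ⟨.β i, k, l⟩ => (w (.β i) k).map fun l' => ⟨.x i, l', l⟩

/-- The neighbour in the upper one of the two columns of a coordinate. -/
def chainHi (w : LacingDiagram d) : Coord d → Option (GlIndex d)
  | ⟨.α i, k, l⟩ => (w (.α i) k).map fun l' => ⟨.x i, l', l⟩
  | ⟨.β i, k, l⟩ => ((w (.β i)).symm l).map fun k' => ⟨.y i.succ, k, k'⟩

theorem chainLo_α (w : LacingDiagram d) {i k l g} : w.chainLo ⟨.α i, k, l⟩ = some g ↔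
    ∃ k', l ∈ w (.α i) k' ∧ (⟨.y i.castSucc, k, k'⟩ : GlIndex d) = g := by
  refine Option.map_eq_some_iff.trans (exists_congr fun k' => and_congr ?_ Iff.rfl)
  exact (w (.α i)).mem_iff_mem

theorem chainLo_β (w : LacingDiagram d) {i k l g} : w.chainLo ⟨.β i, k, l⟩ = some g ↔
    ∃ l', l' ∈ w (.β i) k ∧ (⟨.x i, l', l⟩ : GlIndex d) = g :=
  Option.map_eq_some_iff

theorem chainHi_α (w : LacingDiagram d) {i k l g} : w.chainHi ⟨.α i, k, l⟩ = some g ↔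
    ∃ l', l' ∈ w (.α i) k ∧ (⟨.x i, l', l⟩ : GlIndex d) = g :=
  Option.map_eq_some_iff

theorem chainHi_β (w : LacingDiagram d) {i k l g} : w.chainHi ⟨.β i, k, l⟩ = some g ↔
    ∃ k', l ∈ w (.β i) k' ∧ (⟨.y i.succ, k, k'⟩ : GlIndex d) = g := by
  refine Option.map_eq_some_iff.trans (exists_congr fun k' => and_congr ?_ Iff.rfl)
  exact (w (.β i)).mem_iff_mem

/-- The chains of the differential of the orbit map of a lacing diagram. The vertices are ordered
`y_0, x_1, y_1, …, x_n, y_n`, so that `lo` and `hi` are the right and the left neighbour. -/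
def chain (w : LacingDiagram d) : ChainData (Coord d) (GlIndex d) where
  lo := w.chainLo
  hi := w.chainHi
  pos
    | ⟨.α i, _⟩ => 2 * i
    | ⟨.β i, _⟩ => 2 * i + 1
  lo_inj := by
    rintro ⟨i | i, k, l⟩ ⟨i' | i', k', l'⟩ g h h' <;>
      simp only [chainLo_α, chainLo_β] at h h' <;>
      obtain ⟨a, ha, rfl⟩ := h <;> obtain ⟨a', ha', h'⟩ := h'
    · simp only [Sigma.mk.injEq, Vertex.y.injEq, Fin.castSucc_inj] at h'
      obtain ⟨rfl, h'⟩ := h'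
      obtain ⟨rfl, rfl⟩ := Prod.mk.inj (eq_of_heq h')
      rw [Option.mem_unique ha ha']
    · simp at h'
    · simp at h'
    · simp only [Sigma.mk.injEq, Vertex.x.injEq] at h'
      obtain ⟨rfl, h'⟩ := h'
      obtain ⟨rfl, rfl⟩ := Prod.mk.inj (eq_of_heq h')
      rw [(w (.β i')).inj ha ha']
  hi_inj := by
    rintro ⟨i | i, k, l⟩ ⟨i' | i', k', l'⟩ g h h' <;>
      simp only [chainHi_α, chainHi_β] at h h' <;>
      obtain ⟨a, ha, rfl⟩ := h <;> obtain ⟨a', ha', h'⟩ := h'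
    · simp only [Sigma.mk.injEq, Vertex.x.injEq] at h'
      obtain ⟨rfl, h'⟩ := h'
      obtain ⟨rfl, rfl⟩ := Prod.mk.inj (eq_of_heq h')
      rw [(w (.α i')).inj ha ha']
    · simp at h'
    · simp at h'
    · simp only [Sigma.mk.injEq, Vertex.y.injEq, Fin.succ_inj] at h'
      obtain ⟨rfl, h'⟩ := h'
      obtain ⟨rfl, rfl⟩ := Prod.mk.inj (eq_of_heq h')
      rw [Option.mem_unique ha ha']
  pos_lt := by
    rintro ⟨i | i, k, l⟩ ⟨i' | i', k', l'⟩ g h h' <;>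
      simp only [chainLo_α, chainLo_β, chainHi_α, chainHi_β] at h h' <;>
      obtain ⟨a, ha, rfl⟩ := h <;> obtain ⟨a', ha', h'⟩ := h' <;>
      have := congrArg Sigma.fst h'
    · simp at this
    · simp only [Vertex.y.injEq, Fin.ext_iff, Fin.val_succ, Fin.val_castSucc] at this
      simp only
      omega
    · simp only [Vertex.x.injEq] at this
      simp only [this]
      omega
    · simp at this

/-- The crossings of a lacing diagram when the dots of each column are ordered by a relation. -/
def crossingSet (w : LacingDiagram d) (lt : ∀ z, Fin (d z) → Fin (d z) → Prop) :
    Set (Coord d) :=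
  {c | w.chain.IsCrossing (fun g => lt g.1 g.2.1 g.2.2) (fun g => lt g.1 g.2.2 g.2.1) c}

theorem mem_crossingSet_α (w : LacingDiagram d) (lt : ∀ z, Fin (d z) → Fin (d z) → Prop)
    (i : Fin n) (k : Fin (d (Arrow.α i).tail)) (l : Fin (d (Arrow.α i).head)) :
    (⟨.α i, k, l⟩ : Coord d) ∈ w.crossingSet lt ↔
      (∀ l' ∈ w (.α i) k, lt (.x i) l' l) ∧
        ∀ k', l ∈ w (.α i) k' → lt (.y i.castSucc) k' k := by
  change (∀ g, w.chainHi ⟨.α i, k, l⟩ = some g → _) ∧ (∀ g, w.chainLo ⟨.α i, k, l⟩ = some g → _) ↔ _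
  simp only [chainHi_α, chainLo_α, forall_exists_index, and_imp]
  refine and_congr ⟨fun h l' hl' => h _ l' hl' rfl, ?_⟩ ⟨fun h k' hk' => h _ k' hk' rfl, ?_⟩
  · rintro h g l' hl' rfl
    exact h l' hl'
  · rintro h g k' hk' rfl
    exact h k' hk'

theorem mem_crossingSet_β (w : LacingDiagram d) (lt : ∀ z, Fin (d z) → Fin (d z) → Prop)
    (i : Fin n) (k : Fin (d (Arrow.β i).tail)) (l : Fin (d (Arrow.β i).head)) :
    (⟨.β i, k, l⟩ : Coord d) ∈ w.crossingSet lt ↔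
      (∀ k', l ∈ w (.β i) k' → lt (.y i.succ) k k') ∧
        ∀ l' ∈ w (.β i) k, lt (.x i) l l' := by
  change (∀ g, w.chainHi ⟨.β i, k, l⟩ = some g → _) ∧ (∀ g, w.chainLo ⟨.β i, k, l⟩ = some g → _) ↔ _
  simp only [chainHi_β, chainLo_β, forall_exists_index, and_imp]
  refine and_congr ⟨fun h k' hk' => h _ k' hk' rfl, ?_⟩ ⟨fun h l' hl' => h _ l' hl' rfl, ?_⟩
  · rintro h g k' hk' rfl
    exact h k' hk'
  · rintro h g l' hl' rfl
    exact h l' hl'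

end LacingDiagram

theorem mem_rot {k l : ℕ} (w : Fin k ≃. Fin l) (i : Fin k) (j : Fin l) :
    j ∈ rot w i ↔ Fin.rev j ∈ w (Fin.rev i) := by
  simp only [rot, PEquiv.mem_trans, Equiv.toPEquiv_apply, Option.mem_some_iff]
  constructor
  · rintro ⟨b, ⟨c, rfl, hb⟩, hj⟩
    rw [Fin.revPerm_apply] at hb hj
    rw [← hj, Fin.rev_rev]
    exact hb
  · intro h
    exact ⟨_, ⟨_, rfl, h⟩, by simp⟩

theorem ncard_eq_sum {ι : Type*} [Fintype ι] {X : ι → Type*} [∀ i, Finite (X i)]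
    (s : Set (Σ i, X i)) : s.ncard = ∑ i, {x : X i | (⟨i, x⟩ : Σ i, X i) ∈ s}.ncard := by
  have e : s ≃ Σ i, {x : X i | (⟨i, x⟩ : Σ i, X i) ∈ s} :=
    { toFun := fun p => ⟨p.1.1, p.1.2, p.2⟩
      invFun := fun p => ⟨⟨p.1, p.2.1⟩, p.2.2⟩
      left_inv := fun _ => rfl
      right_inv := fun _ => rfl }
  rw [← Nat.card_coe_set_eq, Nat.card_congr e, Nat.card_sigma]
  exact Finset.sum_congr rfl fun i _ => Nat.card_coe_set_eq _

namespace LacingDiagram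

/-- For a right-pointing arrow the crossing condition is membership in the Rothe diagram of w_a. For
a left-pointing arrow both inequalities are reversed, which the rotation accounts for. -/
theorem crossings_eq_ncard (w : LacingDiagram d) :
    w.crossings = (w.crossingSet fun _ i j => i < j).ncard := by
  rw [crossings, ncard_eq_sum]
  refine Finset.sum_congr rfl fun a _ => ?_
  cases a with
  | α i =>
    simp only [extended]
    rw [length_rotPerm, length_completion]
    refine Set.ncard_congr (fun p _ => (Fin.rev p.1, Fin.rev p.2)) ?_ ?_ ?_
    · rintro ⟨k, l⟩ ⟨h1, h2⟩
      refine (mem_crossingSet_α w (fun _ i j => i < j) i (Fin.rev k) (Fin.rev l)).2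
        ⟨fun l' hl' => ?_, fun k' hk' => ?_⟩
      · have := h1 (Fin.rev l') ((mem_rot _ _ _).2 (by simpa using hl'))
        exact Fin.lt_rev_iff.1 this
      · have := h2 (Fin.rev k') (((rot (w (.α i))).mem_iff_mem).2
          ((mem_rot _ _ _).2 (by simpa using hk')))
        exact Fin.lt_rev_iff.1 this
    · rintro ⟨k, l⟩ ⟨k', l'⟩ - - h
      simpa using h
    · rintro ⟨k, l⟩ h
      obtain ⟨h1, h2⟩ := (mem_crossingSet_α w (fun _ i j => i < j) i k l).1 h
      refine ⟨(Fin.rev k, Fin.rev l), ⟨fun l' hl' => ?_, fun k' hk' => ?_⟩, by simp⟩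
      · rw [mem_rot] at hl'
        have := h1 _ (by simpa using hl')
        exact Fin.rev_lt_iff.2 this
      · rw [PEquiv.mem_iff_mem, mem_rot] at hk'
        have := h2 _ (by simpa using hk')
        exact Fin.rev_lt_iff.2 this
  | β i =>
    simp only [extended]
    rw [length_completion]
    congr 1
    ext ⟨k, l⟩
    refine Iff.trans ?_ (mem_crossingSet_β w (fun _ i j => i < j) i k l).symm
    constructor
    · rintro ⟨h1, h2⟩
      exact ⟨fun k' hk' => h2 _ ((w (.β i)).mem_iff_mem.2 hk'), h1⟩
    · rintro ⟨h1, h2⟩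
      exact ⟨h2, fun k' hk' => h1 _ ((w (.β i)).mem_iff_mem.1 hk')⟩

/-- The entries of a tuple of matrices as a family of scalars. -/
def glEquiv (d : Vertex n → ℕ) (K : Type*) [Field K] : Gl d K ≃ₗ[K] (GlIndex d → K) where
  toFun A g := A g.1 g.2.1 g.2.2
  invFun f z := Matrix.of fun i j => f ⟨z, i, j⟩
  map_add' _ _ := rfl
  map_smul' _ _ := rfl
  left_inv _ := rfl
  right_inv _ := rfl

theorem chain_represents (w : LacingDiagram d) (K : Type*) [Field K] :
    w.chain.Represents (infinitesimal (w.toRep K)) (glEquiv d K) := by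
  have h1 : ∀ (A : Gl d K) (a : Arrow n) k l, infinitesimal (w.toRep K) A ⟨a, k, l⟩ =
      (w a k).elim 0 (fun l' => A a.head l' l) - ((w a).symm l).elim 0 fun k' => A a.tail k k' := by
    intro A a k l
    have h2 : (w.toRep K a * A a.head) k l = (w a k).elim 0 (fun l' => A a.head l' l) := by
      rw [toRep, PEquiv.toMatrix_mul_apply]
      cases w a k <;> rfl
    have h3 : (A a.tail * w.toRep K a) k l = ((w a).symm l).elim 0 fun k' => A a.tail k k' := by
      rw [toRep, PEquiv.mul_toMatrix_apply]
      cases (w a).symm l <;> rfl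
    rw [← h2, ← h3]
    rfl
  -- The positive term V_a A_{ha} is the upper neighbour for α but the lower one for β, whence the
  -- sign.
  refine ⟨fun c => match c with
    | ⟨.α _, _⟩ => 1
    | ⟨.β _, _⟩ => -1, ?_, ?_⟩
  · rintro ⟨i | i, -⟩ <;> simp
  · rintro A ⟨i | i, k, l⟩
    · rw [h1, one_mul]
      simp only [chain, chainLo, chainHi, valueAt]
      congr 1
      · cases w (.α i) k <;> rfl
      · cases (w (.α i)).symm l <;> rfl
    · rw [h1, neg_one_mul, neg_sub]
      simp only [chain, chainLo, chainHi, valueAt]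
      congr 1
      · cases w (.β i) k <;> rfl
      · cases (w (.β i)).symm l <;> rfl

/-- For the usual order the neutral pairs are the diagonal entries. If one neighbour of (k, l) is
diagonal, then k and l are joined in w_a, and the other neighbour is diagonal too. -/
theorem card_coord_le (w : LacingDiagram d) (K : Type*) [Field K] :
    Fintype.card (Coord d) ≤
      Module.finrank K (LinearMap.range (infinitesimal (w.toRep K))) + w.crossings := by
  rw [crossings_eq_ncard]
  refine ChainData.card_le_finrank_range_add (w.chain_represents K)
    (fun g => fun h => not_lt.2 h.le) ⟨?_, ?_⟩
  · rintro ⟨i | i, k, l⟩ g h hP hN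
    · obtain ⟨a, ha, rfl⟩ := w.chainLo_α.1 h
      obtain rfl : k = a := le_antisymm (not_lt.1 hN) (not_lt.1 hP)
      exact ⟨⟨.x i, l, l⟩, w.chainHi_α.2 ⟨l, ha, rfl⟩, lt_irrefl _, lt_irrefl _⟩
    · obtain ⟨a, ha, rfl⟩ := w.chainLo_β.1 h
      obtain rfl : a = l := le_antisymm (not_lt.1 hN) (not_lt.1 hP)
      exact ⟨⟨.y i.succ, k, k⟩, w.chainHi_β.2 ⟨k, ha, rfl⟩, lt_irrefl _, lt_irrefl _⟩
  · rintro ⟨i | i, k, l⟩ g h hP hN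
    · obtain ⟨a, ha, rfl⟩ := w.chainHi_α.1 h
      obtain rfl : a = l := le_antisymm (not_lt.1 hN) (not_lt.1 hP)
      exact ⟨⟨.y i.castSucc, k, k⟩, w.chainLo_α.2 ⟨k, ha, rfl⟩, lt_irrefl _, lt_irrefl _⟩
    · obtain ⟨a, ha, rfl⟩ := w.chainHi_β.1 h
      obtain rfl : k = a := le_antisymm (not_lt.1 hN) (not_lt.1 hP)
      exact ⟨⟨.x i, l, l⟩, w.chainLo_β.2 ⟨l, ha, rfl⟩, lt_irrefl _, lt_irrefl _⟩

end LacingDiagram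

end BipartiteA

namespace BipartiteA

variable {n : ℕ} {d : Vertex n → ℕ}

namespace LacingDiagram

/-! ### Laces -/

/-- The dots of a lacing diagram. -/
abbrev Dot (d : Vertex n → ℕ) : Type := Σ z : Vertex n, Fin (d z)

/-- The position of a column, counted from the right. -/
def column : Vertex n → ℕ
  | .y i => 2 * i
  | .x i => 2 * i + 1

theorem column_le (z : Vertex n) : column z ≤ 2 * n := by
  rcases z with i | i
  · have := i.2
    simp only [column]
    omega
  · have := i.2
    simp only [column]
    omega

/-- The second dot is the left neighbour of the first dot on a lace. -/
inductive Link (w : LacingDiagram d) : Dot d → Dot d → Prop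
  | α (i : Fin n) (k l) (h : l ∈ w (.α i) k) : Link w ⟨.y i.castSucc, k⟩ ⟨.x i, l⟩
  | β (i : Fin n) (k l) (h : l ∈ w (.β i) k) : Link w ⟨.x i, l⟩ ⟨.y i.succ, k⟩

theorem Link.column_eq {w : LacingDiagram d} {u v : Dot d} (h : w.Link u v) :
    column v.1 = column u.1 + 1 := by
  cases h
  · simp [column]
  · simp only [column, Fin.val_succ]
    omega

theorem Link.eq_of_castSucc {w : LacingDiagram d} {i : Fin n} {k} {v : Dot d}
    (h : w.Link ⟨.y i.castSucc, k⟩ v) : ∃ l ∈ w (.α i) k, v = ⟨.x i, l⟩ := by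
  generalize hu : (⟨.y i.castSucc, k⟩ : Dot d) = u at h
  cases h with
  | α i' k' l h =>
    obtain rfl := Fin.castSucc_injective n (Vertex.y.inj (Sigma.mk.inj hu).1)
    obtain rfl := eq_of_heq (Sigma.mk.inj hu).2
    exact ⟨l, h, rfl⟩
  | β i' k' l h => exact Vertex.noConfusion rfl (heq_of_eq (Sigma.mk.inj hu).1)

theorem Link.eq_of_x {w : LacingDiagram d} {i : Fin n} {l} {v : Dot d}
    (h : w.Link ⟨.x i, l⟩ v) : ∃ k, l ∈ w (.β i) k ∧ v = ⟨.y i.succ, k⟩ := by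
  cases h with
  | β _ k l h => exact ⟨k, h, rfl⟩

theorem Link.eq_of_to_succ {w : LacingDiagram d} {i : Fin n} {k} {u : Dot d}
    (h : w.Link u ⟨.y i.succ, k⟩) : ∃ l ∈ w (.β i) k, u = ⟨.x i, l⟩ := by
  generalize hv : (⟨.y i.succ, k⟩ : Dot d) = v at h
  cases h with
  | α i' k' l h => exact Vertex.noConfusion rfl (heq_of_eq (Sigma.mk.inj hv).1)
  | β i' k' l h =>
    obtain rfl := Fin.succ_injective n (Vertex.y.inj (Sigma.mk.inj hv).1)
    obtain rfl := eq_of_heq (Sigma.mk.inj hv).2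
    exact ⟨l, h, rfl⟩

theorem Link.eq_of_to_x {w : LacingDiagram d} {i : Fin n} {l} {u : Dot d}
    (h : w.Link u ⟨.x i, l⟩) : ∃ k, l ∈ w (.α i) k ∧ u = ⟨.y i.castSucc, k⟩ := by
  cases h with
  | α _ k l h => exact ⟨k, h, rfl⟩

theorem Link.right_unique {w : LacingDiagram d} {u v v' : Dot d} (h : w.Link u v)
    (h' : w.Link u v') : v = v' := by
  cases h with
  | α i k l h =>
    obtain ⟨l', hl', rfl⟩ := h'.eq_of_castSucc
    rw [Option.mem_unique h hl']
  | β i k l h =>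
    obtain ⟨k', hk', rfl⟩ := h'.eq_of_x
    rw [(w (.β i)).inj h hk']

theorem Link.left_unique {w : LacingDiagram d} {u u' v : Dot d} (h : w.Link u v)
    (h' : w.Link u' v) : u = u' := by
  cases h with
  | α i k l h =>
    obtain ⟨k', hk', rfl⟩ := h'.eq_of_to_x
    rw [(w (.α i)).inj h hk']
  | β i k l h =>
    obtain ⟨l', hl', rfl⟩ := h'.eq_of_to_succ
    rw [Option.mem_unique h hl']

/-- The ends of the laces. -/
structure LaceEnds (w : LacingDiagram d) where
  /-- the left end of the lace through a dot -/
  hi : Dot d → Dot d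
  /-- the right end of the lace through a dot -/
  lo : Dot d → Dot d
  hi_eq : ∀ {u v}, w.Link u v → hi u = hi v
  lo_eq : ∀ {u v}, w.Link u v → lo u = lo v
  hi_self : ∀ {u}, (∀ v, ¬w.Link u v) → hi u = u
  lo_self : ∀ {u}, (∀ v, ¬w.Link v u) → lo u = u
  le_hi : ∀ u, column u.1 ≤ column (hi u).1
  lo_le : ∀ u, column (lo u).1 ≤ column u.1
  hi_inj : ∀ {u v}, hi u = hi v → column u.1 = column v.1 → u = v

theorem exists_laceEnds (w : LacingDiagram d) : Nonempty w.LaceEnds := by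
  obtain ⟨e, h1, h2, h3, h4⟩ := exists_pathEnd w.Link (fun u => column u.1) (2 * n)
    (fun u => column_le u.1) (fun u v h => h.column_eq) (fun u v v' h h' => h.right_unique h')
    (fun u u' v h h' => h.left_unique h')
  obtain ⟨f, g1, g2, g3, -⟩ := exists_pathEnd (fun u v => w.Link v u)
    (fun u => 2 * n - column u.1) (2 * n) (fun u => Nat.sub_le _ _)
    (fun u v h => by
      have := h.column_eq
      have := column_le u.1
      omega)
    (fun u v v' h h' => h.left_unique h') (fun u u' v h h' => h.right_unique h')
  exact ⟨e, f, fun h => h1 _ _ h, fun h => (g1 _ _ h).symm, fun h => h2 _ h, fun h => g2 _ h, h3,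
    fun u => by
      have h5 := g3 u
      have h6 := column_le u.1
      have h7 := column_le (f u).1
      omega, fun h h' => h4 _ _ h h'⟩

/-- The rank of a left end of a lace: sources first, from right to left, then sinks, from left to
right. -/
def hiRank (n t : ℕ) : ℤ := if t % 2 = 0 then t - (4 * n + 2) else -t

/-- The rank of a right end of a lace: sinks first, from left to right, then sources, from right to
left. -/
def loRank (t : ℕ) : ℤ := if t % 2 = 0 then t else -t

/-- Columns are at most 2n, so the shift by 4n + 2 places all sources before all sinks. A lace
ending at a source must precede those that continue to the left, and one ending at a sink must
follow them. -/
theorem hiRank_lt_of_even {t t' : ℕ} (h : t % 2 = 0) (hlt : t < t') (hn : t' ≤ 2 * n) :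
    hiRank n t < hiRank n t' := by
  rw [hiRank, hiRank]
  split_ifs <;> omega

theorem hiRank_lt_of_odd {t t' : ℕ} (h : t % 2 = 1) (hlt : t < t') (hn : t' ≤ 2 * n) :
    hiRank n t' < hiRank n t := by
  rw [hiRank, hiRank]
  split_ifs <;> omega

theorem loRank_lt_of_even {t t' : ℕ} (h : t % 2 = 0) (hlt : t' < t) : loRank t' < loRank t := by
  rw [loRank, loRank]
  split_ifs <;> omega

theorem loRank_lt_of_odd {t t' : ℕ} (h : t % 2 = 1) (hlt : t' < t) : loRank t < loRank t' := by
  rw [loRank, loRank]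
  split_ifs <;> omega

namespace LaceEnds

variable {w : LacingDiagram d} (e : w.LaceEnds)

/-- The position of a lace in a total order of all laces. -/
noncomputable def key (u : Dot d) : ℤ ×ₗ ℤ ×ₗ ℕ :=
  toLex (hiRank n (column (e.hi u).1),
    toLex (loRank (column (e.lo u).1), (Fintype.equivFin (Dot d) (e.hi u) : ℕ)))

theorem key_eq {u v : Dot d} (h : w.Link u v) : e.key u = e.key v := by
  rw [key, key, e.hi_eq h, e.lo_eq h]

/-- The last component records the left end, which together with the column determines the dot. -/
theorem key_injective (z : Vertex n) : Function.Injective fun i => e.key ⟨z, i⟩ := by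
  intro i j h
  have h1 := congrArg (fun k : ℤ ×ₗ ℤ ×ₗ ℕ => (ofLex (ofLex k).2).2) h
  simp only [key, ofLex_toLex] at h1
  have h2 := (Fintype.equivFin (Dot d)).injective (Fin.ext h1)
  have h3 := e.hi_inj h2 rfl
  simpa using h3

theorem key_lt_of_hiRank_lt {u v : Dot d}
    (h : hiRank n (column (e.hi u).1) < hiRank n (column (e.hi v).1)) : e.key u < e.key v :=
  Prod.Lex.toLex_lt_toLex.2 (Or.inl h)

theorem hiRank_lt_of_key_lt {u v : Dot d} (h : e.key u < e.key v)
    (h' : loRank (column (e.lo v).1) < loRank (column (e.lo u).1)) :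
    hiRank n (column (e.hi u).1) < hiRank n (column (e.hi v).1) := by
  rcases Prod.Lex.toLex_lt_toLex.1 h with h | ⟨-, h⟩
  · exact h
  · rcases Prod.Lex.toLex_lt_toLex.1 h with h | ⟨h, -⟩
    · exact absurd h h'.asymm
    · exact absurd h h'.ne'

theorem lt_hi {u v : Dot d} (h : w.Link u v) : column u.1 < column (e.hi u).1 := by
  have h1 := h.column_eq
  have h2 := e.le_hi v
  rw [e.hi_eq h]
  omega

theorem lo_lt {u v : Dot d} (h : w.Link u v) : column (e.lo v).1 < column v.1 := by
  have h1 := h.column_eq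
  have h2 := e.lo_le u
  rw [← e.lo_eq h]
  omega

/-- Here `Q` says that the right ends are ranked oppositely to the pair. If `P` and `Q` both hold,
the tie-break by right ends cannot have decided `P`, so the left ends are strictly ranked. Were the
chain to stop in `G` above this pair, one of the two laces would end in this column at the left, and
its extreme rank would contradict that strict inequality. -/
theorem finrank_add_le (K : Type*) [Field K] :
    Module.finrank K (LinearMap.range (infinitesimal (w.toRep K))) +
      (w.crossingSet fun z i j => e.key ⟨z, i⟩ < e.key ⟨z, j⟩).ncard ≤
        Fintype.card (Coord d) := by
  refine ChainData.finrank_range_add_le (w.chain_represents K)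
    (Q := fun g => loRank (column (e.lo ⟨g.1, g.2.2⟩).1) < loRank (column (e.lo ⟨g.1, g.2.1⟩).1))
    (fun g h => h.asymm) ?_ ?_ ?_ ?_ ?_
  · rintro ⟨i | i, k, l⟩ g g' h h'
    · obtain ⟨k', hk', rfl⟩ := w.chainLo_α.1 h
      obtain ⟨l', hl', rfl⟩ := w.chainHi_α.1 h'
      simp only
      rw [e.key_eq (.α i k l' hl'), e.key_eq (.α i k' l hk')]
    · obtain ⟨l', hl', rfl⟩ := w.chainLo_β.1 h
      obtain ⟨k', hk', rfl⟩ := w.chainHi_β.1 h'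
      simp only
      rw [e.key_eq (.β i k l' hl'), e.key_eq (.β i k' l hk')]
  · rintro ⟨i | i, k, l⟩ g g' h h'
    · obtain ⟨k', hk', rfl⟩ := w.chainLo_α.1 h
      obtain ⟨l', hl', rfl⟩ := w.chainHi_α.1 h'
      simp only
      rw [e.lo_eq (.α i k l' hl'), e.lo_eq (.α i k' l hk')]
    · obtain ⟨l', hl', rfl⟩ := w.chainLo_β.1 h
      obtain ⟨k', hk', rfl⟩ := w.chainHi_β.1 h'
      simp only
      rw [e.lo_eq (.β i k l' hl'), e.lo_eq (.β i k' l hk')]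
  · rintro ⟨i | i, k, l⟩ g h h'
    · obtain ⟨k', hk', rfl⟩ := w.chainLo_α.1 h'
      have hself : e.hi ⟨.y i.castSucc, k⟩ = ⟨.y i.castSucc, k⟩ := by
        refine e.hi_self fun v hv => ?_
        obtain ⟨l', hl', -⟩ := hv.eq_of_castSucc
        have := h.symm.trans (w.chainHi_α.2 ⟨l', hl', rfl⟩)
        simp at this
      refine e.key_lt_of_hiRank_lt ?_
      rw [hself]
      refine hiRank_lt_of_even (by simp [column]) ?_ (column_le _)
      exact e.lt_hi (.α i k' l hk')
    · obtain ⟨l', hl', rfl⟩ := w.chainLo_β.1 h'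
      have hself : e.hi ⟨.x i, l⟩ = ⟨.x i, l⟩ := by
        refine e.hi_self fun v hv => ?_
        obtain ⟨k', hk', -⟩ := hv.eq_of_x
        have := h.symm.trans (w.chainHi_β.2 ⟨k', hk', rfl⟩)
        simp at this
      refine e.key_lt_of_hiRank_lt ?_
      rw [hself]
      refine hiRank_lt_of_odd (by simp [column]) ?_ (column_le _)
      exact e.lt_hi (.β i k l' hl')
  · rintro ⟨i | i, k, l⟩ g h h'
    · obtain ⟨l', hl', rfl⟩ := w.chainHi_α.1 h'
      have hself : e.lo ⟨.x i, l⟩ = ⟨.x i, l⟩ := by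
        refine e.lo_self fun v hv => ?_
        obtain ⟨k', hk', -⟩ := hv.eq_of_to_x
        have := h.symm.trans (w.chainLo_α.2 ⟨k', hk', rfl⟩)
        simp at this
      simp only
      rw [hself]
      refine loRank_lt_of_odd (by simp [column]) ?_
      exact e.lo_lt (.α i k l' hl')
    · obtain ⟨k', hk', rfl⟩ := w.chainHi_β.1 h'
      have hself : e.lo ⟨.y i.succ, k⟩ = ⟨.y i.succ, k⟩ := by
        refine e.lo_self fun v hv => ?_
        obtain ⟨l', hl', -⟩ := hv.eq_of_to_succ
        have := h.symm.trans (w.chainLo_β.2 ⟨l', hl', rfl⟩)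
        simp at this
      simp only
      rw [hself]
      refine loRank_lt_of_even (by simp [column]) ?_
      exact e.lo_lt (.β i k' l hk')
  · rintro ⟨i | i, p, q⟩ hP hQ
    · have hlt := e.hiRank_lt_of_key_lt hP hQ
      by_contra hno
      have hself : e.hi ⟨.y i, q⟩ = ⟨.y i, q⟩ := by
        refine e.hi_self fun v hv => hno ?_
        cases hv with
        | α i k l h => exact ⟨⟨.α i, p, l⟩, w.chainLo_α.2 ⟨k, h, rfl⟩⟩
      rw [hself] at hlt
      have hle := e.le_hi ⟨.y i, p⟩
      rcases hle.eq_or_lt with heq | hlt'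
      · rw [← heq] at hlt
        exact lt_irrefl _ hlt
      · exact absurd hlt (hiRank_lt_of_even (by simp [column]) hlt' (column_le _)).asymm
    · have hlt := e.hiRank_lt_of_key_lt hP hQ
      by_contra hno
      have hself : e.hi ⟨.x i, p⟩ = ⟨.x i, p⟩ := by
        refine e.hi_self fun v hv => hno ?_
        obtain ⟨k, hk, -⟩ := hv.eq_of_x
        exact ⟨⟨.β i, k, q⟩, w.chainLo_β.2 ⟨p, hk, rfl⟩⟩
      rw [hself] at hlt
      have hle := e.le_hi ⟨.x i, q⟩
      rcases hle.eq_or_lt with heq | hlt'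
      · rw [← heq] at hlt
        exact lt_irrefl _ hlt
      · exact absurd hlt (hiRank_lt_of_odd (by simp [column]) hlt' (column_le _)).asymm

end LaceEnds

/-! ### Reordering the dots -/

/-- The lacing diagram in which the dots of each column are permuted. -/
def permute (w : LacingDiagram d) (σ : ∀ z, Equiv.Perm (Fin (d z))) : LacingDiagram d :=
  fun a => ((σ a.tail).toPEquiv.trans (w a)).trans (σ a.head).symm.toPEquiv

theorem mem_permute (w : LacingDiagram d) (σ : ∀ z, Equiv.Perm (Fin (d z))) (a : Arrow n) (k l) :
    l ∈ w.permute σ a k ↔ σ a.head l ∈ w a (σ a.tail k) := by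
  simp only [permute, PEquiv.mem_trans, Equiv.toPEquiv_apply, Option.mem_some_iff]
  constructor
  · rintro ⟨b, ⟨c, rfl, hb⟩, rfl⟩
    simpa using hb
  · intro h
    exact ⟨_, ⟨_, rfl, h⟩, by simp⟩

theorem toRep_permute_mem_orbit (w : LacingDiagram d) (σ : ∀ z, Equiv.Perm (Fin (d z)))
    (K : Type*) [Field K] : (w.permute σ).toRep K ∈ orbit (w.toRep K) := by
  have hinv : ∀ z (τ : Equiv.Perm (Fin (d z))),
      (τ.toPEquiv.toMatrix * τ.symm.toPEquiv.toMatrix : Matrix (Fin (d z)) (Fin (d z)) K) = 1 := by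
    intro z τ
    rw [← PEquiv.toMatrix_trans, ← Equiv.toPEquiv_trans, Equiv.self_trans_symm,
      Equiv.toPEquiv_refl, PEquiv.toMatrix_refl]
  refine ⟨fun z => ⟨(σ z).symm.toPEquiv.toMatrix, (σ z).toPEquiv.toMatrix,
    hinv z (σ z).symm, hinv z (σ z)⟩, ?_⟩
  funext a
  simp only [toRep, permute, PEquiv.toMatrix_trans]
  rfl

theorem crossings_permute (w : LacingDiagram d) (σ : ∀ z, Equiv.Perm (Fin (d z)))
    (lt : ∀ z, Fin (d z) → Fin (d z) → Prop)
    (hσ : ∀ z i j, lt z (σ z i) (σ z j) ↔ i < j) :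
    (w.permute σ).crossings = (w.crossingSet lt).ncard := by
  rw [crossings_eq_ncard]
  have key : ∀ a k l, (⟨a, k, l⟩ : Coord d) ∈ (w.permute σ).crossingSet (fun _ i j => i < j) ↔
      (⟨a, σ a.tail k, σ a.head l⟩ : Coord d) ∈ w.crossingSet lt := by
    rintro (i | i) k l
    · rw [mem_crossingSet_α, mem_crossingSet_α]
      refine and_congr ?_ ?_
      · refine Iff.trans ?_ (σ (Arrow.α i).head).surjective.forall.symm
        refine forall_congr' fun l' => imp_congr (mem_permute _ _ _ _ _) (hσ (.x i) _ _).symm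
      · refine Iff.trans ?_ (σ (Arrow.α i).tail).surjective.forall.symm
        refine forall_congr' fun k' => imp_congr (mem_permute _ _ _ _ _)
          (hσ (.y i.castSucc) _ _).symm
    · rw [mem_crossingSet_β, mem_crossingSet_β]
      refine and_congr ?_ ?_
      · refine Iff.trans ?_ (σ (Arrow.β i).tail).surjective.forall.symm
        refine forall_congr' fun k' => imp_congr (mem_permute _ _ _ _ _)
          (hσ (.y i.succ) _ _).symm
      · refine Iff.trans ?_ (σ (Arrow.β i).head).surjective.forall.symm
        refine forall_congr' fun l' => imp_congr (mem_permute _ _ _ _ _) (hσ (.x i) _ _).symm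
  refine Set.ncard_congr (fun c _ => ⟨c.1, σ c.1.tail c.2.1, σ c.1.head c.2.2⟩) ?_ ?_ ?_
  · rintro ⟨a, k, l⟩ h
    exact (key a k l).1 h
  · rintro ⟨a, k, l⟩ ⟨a', k', l'⟩ - - h
    simp only [Sigma.mk.injEq] at h
    obtain ⟨rfl, h⟩ := h
    simpa using eq_of_heq h
  · rintro ⟨a, k, l⟩ h
    refine ⟨⟨a, (σ a.tail).symm k, (σ a.head).symm l⟩, (key _ _ _).2 ?_, ?_⟩ <;> simp [h]

/-- Some lacing diagram in the orbit of `w` has as many crossings as the corank of the differential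
of the orbit map. -/
theorem exists_crossings_add_le (w : LacingDiagram d) (K : Type*) [Field K] :
    ∃ w' : LacingDiagram d, w'.toRep K ∈ orbit (w.toRep K) ∧
      Module.finrank K (LinearMap.range (infinitesimal (w.toRep K))) + w'.crossings ≤
        Fintype.card (Coord d) := by
  obtain ⟨e⟩ := w.exists_laceEnds
  let σ : ∀ z, Equiv.Perm (Fin (d z)) := fun z => Tuple.sort fun i => e.key ⟨z, i⟩
  have hσ : ∀ z, StrictMono ((fun i => e.key ⟨z, i⟩) ∘ σ z) := fun z =>
    (Tuple.monotone_sort _).strictMono_of_injective ((e.key_injective z).comp (σ z).injective)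
  refine ⟨w.permute σ, w.toRep_permute_mem_orbit σ K, ?_⟩
  rw [w.crossings_permute σ (fun z i j => e.key ⟨z, i⟩ < e.key ⟨z, j⟩)
    fun z i j => (hσ z).lt_iff_lt]
  exact e.finrank_add_le K

end LacingDiagram

/-! ### The main theorem -/

theorem act_act {K : Type*} [Field K] (V : Rep d K) (g h : GLd d K) :
    act (act V g) h = act V (g * h) := by
  funext a
  simp only [act, Pi.mul_apply, mul_inv_rev, Units.val_mul, Matrix.mul_assoc]

theorem orbit_eq_of_mem {K : Type*} [Field K] {V W : Rep d K} (h : W ∈ orbit V) :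
    orbit W = orbit V := by
  obtain ⟨g, rfl⟩ := h
  ext U
  constructor
  · rintro ⟨h, rfl⟩
    exact ⟨g * h, (act_act V g h).symm⟩
  · rintro ⟨h, rfl⟩
    exact ⟨g⁻¹ * h, by rw [act_act, mul_inv_cancel_left]⟩

theorem baseChange_mem_orbit {K : Type*} [Field K] (L : Type*) [Field L] [Algebra K L]
    {V W : Rep d K} (h : W ∈ orbit V) : baseChange L W ∈ orbit (baseChange L V) := by
  obtain ⟨g, rfl⟩ := h
  refine ⟨fun z => Matrix.GeneralLinearGroup.map (algebraMap K L) (g z), ?_⟩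
  funext a
  simp only [act, baseChange]
  rw [Matrix.map_mul, Matrix.map_mul, ← map_inv]
  rfl

end BipartiteA

theorem mainTheorem4 (K L : Type*) [Field K] [Field L] [Algebra K L] [Infinite L]
    {n : ℕ} (d : BipartiteA.Vertex n → ℕ) (V : BipartiteA.Rep d K)
    (w : BipartiteA.LacingDiagram d) (hw : BipartiteA.LacingDiagram.IsMinimal V w) :
    (w.crossings : ℕ∞) = BipartiteA.codim K (BipartiteA.quiverLocus L V) := by
  obtain ⟨hwV, hmin⟩ := hw
  have hlocus : BipartiteA.quiverLocus L V = BipartiteA.quiverLocus L (w.toRep K) := by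
    rw [BipartiteA.quiverLocus, BipartiteA.quiverLocus,
      BipartiteA.orbit_eq_of_mem (BipartiteA.baseChange_mem_orbit L hwV)]
  rw [hlocus, BipartiteA.codim_quiverLocus_eq_corank]
  obtain ⟨w', hw', h1⟩ := w.exists_crossings_add_le K
  -- Minimality compares `w` with the sorted diagram, closing the circle of inequalities.
  have h2 := hmin w' (BipartiteA.orbit_eq_of_mem hwV ▸ hw')
  have h3 := w.card_coord_le K
  congr 1
  omega
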